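/- Let $0\le\alpha<1$. Let $\mathcal F(\alpha)$ be the set of harmonic functions $f=h+\overline g$ on the unit disk $\mathbb D=\{|z|<1\}$, with $h,g$ analytic in $\mathbb D$, $h(z)=z+\sum_{k\ge2}a_kz^k$ and $g(z)=\sum_{k\ge1}b_kz^k$, such that $h'\neq0$ in $\mathbb D$, $\operatorname{Re}\bigl(1+zh''(z)/h'(z)\bigr)>\alpha$ for all $z\in\mathbb D$, and for some real $\vartheta$, $g'(z)=e^{i\vartheta}zh'(z)$ for all $z\in\mathbb D$. Put $s_n(h)(z)=z+\sum_{k=2}^na_kz^k$ and $s_m(g)(z)=\sum_{k=1}^mb_kz^k$. For $k\ge1$ let $A_k(\alpha)=\frac1{k!}\prod_{j=2}^k(j-2\alpha)$. For $0<r<1$ let $A(r,\alpha)=\frac{1-r^2}{r^2}L(r,\alpha)^2$, where $$L(r,\alpha)=\begin{cases}\dfrac{2r}{1+r}-\log(1+r),&\alpha=0,\\[1ex] 2\log(1+r)-r,&\alpha=\tfrac12,\\[1ex] \dfrac{(1+r)^{2\alpha}(1+r+2\alpha-2r\alpha)-(1+r)(1+2\alpha)}{2\alpha(1+r)(2\alpha-1)},&\alpha\in(0,1)\setminus\{\tfrac12\}.\end{cases}$$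 For integers $n,m\ge1$ and $0<r<1$ set $$\psi(n,m,r,\alpha)=A(r,\alpha)-\sum_{k=n+1}^\infty kA_k(\alpha)r^{k-1}-\sum_{k=m+1}^\infty\frac{k(k-1)}{k-2\alpha}A_k(\alpha)r^{k-1},$$ where both series converge. Then the equation $\psi(n,m,r,\alpha)=0$ has exactly one root $r=r_{n,m}$ in $(0,1)$, and for every $f=h+\overline g\in\mathcal F(\alpha)$ and every $\theta\in\mathbb R$ the harmonic function $s_n(h)(z)+e^{i\theta}\,\overline{s_m(g)(z)}$ is univalent (injective) in the disk $|z|<r_{n,m}$. Moreover, if $\alpha=\tfrac12$ and $l=\min\{n,m\}\ge3$, then $r_{n,m}\ge1-\frac{2\log l}{l}$. -/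

import Mathlib

noncomputable section

namespace HarmonicSections

/-- `f = h + conj g` on the open unit disk with `h`, `g` analytic there, normalized by
`h(0) = g(0) = 0` and `h'(0) = 1`: the class of normalized complex-valued harmonic functions, with
analytic part `h` and co-analytic part `g`. -/
structure NormalizedHarmonic (f h g : ℂ → ℂ) : Prop where
  analytic_h : DifferentiableOn ℂ h (Metric.ball 0 1)
  analytic_g : DifferentiableOn ℂ g (Metric.ball 0 1)
  decomp : ∀ z ∈ Metric.ball (0 : ℂ) 1, f z = h z + (starRingEnd ℂ) (g z)
  h_zero : h 0 = 0
  g_zero : g 0 = 0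
  deriv_h_zero : deriv h 0 = 1

/-- `f = h + conj g` belongs to `F(α)`: `Re (1 + z h''(z) / h'(z)) > α` on the disk (in particular
the quotient makes sense, that is `h'(z) ≠ 0`), and `g'(z) = e^{iθ} z h'(z)` on the disk, for
some real `θ` that does not depend on `z`. -/
structure ClassF (α : ℝ) (f h g : ℂ → ℂ) : Prop extends NormalizedHarmonic f h g where
  deriv_ne_zero : ∀ z ∈ Metric.ball (0 : ℂ) 1, deriv h z ≠ 0
  convex_order : ∀ z ∈ Metric.ball (0 : ℂ) 1,
    α < (1 + z * deriv (deriv h) z / deriv h z).re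
  dilatation : ∃ θ : ℝ, ∀ z ∈ Metric.ball (0 : ℂ) 1,
    deriv g z = Complex.exp (Complex.I * θ) * z * deriv h z

/-- The `k`-th Taylor coefficient of `φ` at the origin. -/
def taylorCoeff (φ : ℂ → ℂ) (k : ℕ) : ℂ := iteratedDeriv k φ 0 / (k.factorial : ℂ)

/-- The `n`-th partial sum `∑_{k=1}^n a_k z^k` of the power series of `φ` (where `φ(0) = 0`). -/
def partialSum (n : ℕ) (φ : ℂ → ℂ) (z : ℂ) : ℂ :=
  ∑ k ∈ Finset.Icc 1 n, taylorCoeff φ k * z ^ k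

/-- The harmonic polynomial `s_n(h)(z) + e^{iθ} conj (s_m(g)(z))`. -/
def harmonicSection (n m : ℕ) (θ : ℝ) (h g : ℂ → ℂ) (z : ℂ) : ℂ :=
  partialSum n h z + Complex.exp (Complex.I * θ) * (starRingEnd ℂ) (partialSum m g z)

/-- `L(r, α)`. -/
def L (r α : ℝ) : ℝ :=
  if α = 0 then 2 * r / (1 + r) - Real.log (1 + r)
  else if α = 1 / 2 then 2 * Real.log (1 + r) - r
  else ((1 + r) ^ (2 * α) * (1 + r + 2 * α - 2 * r * α) - (1 + r) * (1 + 2 * α)) /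
    (2 * α * (1 + r) * (2 * α - 1))

/-- `A(r, α) = ((1 - r²) / r²) L(r, α)²`. -/
def A (r α : ℝ) : ℝ := (1 - r ^ 2) / r ^ 2 * L r α ^ 2

/-- `A_k(α) = (1 / k!) ∏_{j=2}^k (j - 2α)`. -/
def coeffBound (k : ℕ) (α : ℝ) : ℝ :=
  1 / (k.factorial : ℝ) * ∏ j ∈ Finset.Icc 2 k, ((j : ℝ) - 2 * α)

/-- `k A_k(α) r^{k-1}`. -/
def analyticTerm (α r : ℝ) (k : ℕ) : ℝ := (k : ℝ) * coeffBound k α * r ^ (k - 1)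

/-- `(k (k - 1) / (k - 2α)) A_k(α) r^{k-1}`. -/
def coanalyticTerm (α r : ℝ) (k : ℕ) : ℝ :=
  (k : ℝ) * ((k : ℝ) - 1) / ((k : ℝ) - 2 * α) * coeffBound k α * r ^ (k - 1)

/-- `ψ(n, m, r, α)`; the two series run over `k ≥ n + 1` and `k ≥ m + 1`. -/
def psi (n m : ℕ) (r α : ℝ) : ℝ :=
  A r α - ∑' j : ℕ, analyticTerm α r (n + 1 + j) - ∑' j : ℕ, coanalyticTerm α r (m + 1 + j)

end HarmonicSections

end

/-! Fix `r < 1` and two distinct points `z`, `ζ` with `|z|, |ζ| < r`, and write `Δφ = φ(z) - φ(ζ)`.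
If the section takes the same value at both, then `|Δ s_n(h)| = |Δ s_m(g)|`, so `|Δh| - |Δg|` is at
most the sum of the increments of the two Taylor remainders. Those are at most `|z - ζ|` times the
two tails in `psi`, by the sharp coefficient bound `|a_k| ≤ A_k(α)`, the relation `k b_k = e^{iϑ} (k
- 1) a_{k-1}`, and `|z^k - ζ^k| ≤ k r^{k-1} |z - ζ|`.

In the other direction, `h` is convex, and for convex `h` a bound `|N'| ≤ M |h'|` passes to
increments: `|ΔN| ≤ M |Δh|` (`norm_sub_le_mul_norm_sub_of_convex`). On `|z| < r` this gives `|Δg| ≤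
r |Δh|` from the dilatation, and `|Δh| ≥ (1 + r)^{2α-2} |z - ζ|` from the distortion theorem with `N
= id`. Hence `|Δh| - |Δg| ≥ (1 - r)(1 + r)^{2α-2} |z - ζ|`. This constant is `L'(r)`, and it
dominates `A(r, α)` (`A_le_jacobianBound`). So equal values force `psi ≤ 0`.

The root exists and is unique because `A` decreases strictly and the tails increase, with `psi > 0`
near `0` and `psi < 0` near `1`. It follows that `psi > 0` to the left of the root, which gives
univalence there. For `α = 1/2` every `k A_k` equals `1`, the tails are geometric, and `psi ≥ 0` at
`1 - 2 log l / l` can be checked by hand. -/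

namespace HarmonicSections

open Metric Set Filter Topology ComplexConjugate

/-! ### Convex functions and comparison of increments -/

/-- At a point where the real part of a holomorphic function attains its minimum over the closed
disk through that point, the radial derivative is real and nonpositive. -/
theorem exists_nonpos_eq_mul_deriv_of_forall_re_le {F : ℂ → ℂ} {F' w₀ : ℂ}
    (hF : HasDerivAt F F' w₀) (hmin : ∀ w, ‖w‖ ≤ ‖w₀‖ → (F w₀).re ≤ (F w).re) :
    ∃ x : ℝ, x ≤ 0 ∧ w₀ * F' = x := by
  have hcurve : ∀ (γ : ℝ → ℂ) (γ' : ℂ), γ 0 = w₀ → HasDerivAt γ γ' 0 →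
      HasDerivAt (fun t => (F (γ t)).re) (F' * γ').re 0 := by
    intro γ γ' h0 hγ
    have h1 : HasDerivAt (fun t => F (γ t)) (F' * γ') 0 := by
      have := hF
      rw [← h0] at this
      exact this.comp_of_eq (0 : ℝ) hγ rfl
    exact Complex.reCLM.hasFDerivAt.comp_hasDerivAt 0 h1
  refine ⟨(w₀ * F').re, ?_, ?_⟩
  -- Moving radially inwards cannot decrease `Re F`, which gives the sign; rotating about the origin
  -- makes `Re F` stationary, which kills the imaginary part.
  · have h1 := hcurve (fun t => w₀ * (1 - t)) (-w₀) (by simp) (by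
      simpa using (((hasDerivAt_id (0 : ℝ)).ofReal_comp).const_sub 1).const_mul w₀)
    have h2 : IsLocalMinOn (fun t : ℝ => (F (w₀ * (1 - t))).re) (Icc 0 1) 0 := by
      filter_upwards [self_mem_nhdsWithin] with t ht
      have : ‖w₀ * (1 - t)‖ ≤ ‖w₀‖ := by
        rw [norm_mul]
        have : ‖(1 - t : ℂ)‖ ≤ 1 := by
          rw [show (1 - t : ℂ) = ((1 - t : ℝ) : ℂ) by push_cast; ring, Complex.norm_real,
            Real.norm_eq_abs, abs_le]
          constructor <;> linarith [ht.1, ht.2]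
        nlinarith [norm_nonneg w₀]
      simpa using hmin _ this
    have h3 := h2.hasFDerivWithinAt_nonneg h1.hasFDerivAt.hasFDerivWithinAt
      (y := 1) (mem_posTangentConeAt_of_segment_subset (by simp [segment_eq_Icc]))
    simp only [ContinuousLinearMap.toSpanSingleton_apply, one_smul, mul_neg, Complex.neg_re] at h3
    rw [mul_comm]
    linarith
  · have h1 := hcurve (fun t => w₀ * Complex.exp (t * Complex.I)) (w₀ * Complex.I) (by simp) (by
      simpa using ((((hasDerivAt_id (0 : ℝ)).ofReal_comp).mul_const Complex.I).cexp).const_mul w₀)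
    have h2 : IsLocalMin (fun t : ℝ => (F (w₀ * Complex.exp (t * Complex.I))).re) 0 := by
      filter_upwards with t
      have : ‖w₀ * Complex.exp (t * Complex.I)‖ ≤ ‖w₀‖ := by
        simp [Complex.norm_exp_ofReal_mul_I]
      simpa using hmin _ this
    have h3 := h2.hasDerivAt_eq_zero h1
    apply Complex.ext
    · simp
    · simp only [Complex.ofReal_im]
      simp only [Complex.mul_re, Complex.mul_im, Complex.I_re, Complex.I_im] at h3 ⊢
      linarith

/-- A convex univalent function `k` with `k 0 = 0` is starlike:
`Λ = k / (w k')` extends to the disk and has positive real part. -/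
theorem exists_re_pos_of_convex {k k1 k2 : ℂ → ℂ} (hk0 : k 0 = 0)
    (hk : ∀ w ∈ ball (0 : ℂ) 1, HasDerivAt k (k1 w) w)
    (hk1 : ∀ w ∈ ball (0 : ℂ) 1, HasDerivAt k1 (k2 w) w)
    (hne : ∀ w ∈ ball (0 : ℂ) 1, k1 w ≠ 0)
    (hpos : ∀ w ∈ ball (0 : ℂ) 1, 0 < (1 + w * k2 w / k1 w).re) :
    ∃ Λ : ℂ → ℂ, DifferentiableOn ℂ Λ (ball 0 1) ∧
      ∀ w ∈ ball (0 : ℂ) 1, k w = w * Λ w * k1 w ∧ 0 < (Λ w).re := by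
  have hkd : DifferentiableOn ℂ k (ball 0 1) :=
    fun w hw => (hk w hw).differentiableAt.differentiableWithinAt
  have hk1d : DifferentiableOn ℂ k1 (ball 0 1) :=
    fun w hw => (hk1 w hw).differentiableAt.differentiableWithinAt
  have h0 : (0 : ℂ) ∈ ball (0 : ℂ) 1 := by simp
  set Λ : ℂ → ℂ := fun w => dslope k 0 w / k1 w with hΛ
  have hKd : DifferentiableOn ℂ (dslope k 0) (ball 0 1) :=
    (Complex.differentiableOn_dslope (isOpen_ball.mem_nhds h0)).2 hkd
  have hΛd : DifferentiableOn ℂ Λ (ball 0 1) := hKd.div hk1d hne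
  have hfac : ∀ w ∈ ball (0 : ℂ) 1, k w = w * Λ w * k1 w := by
    intro w hw
    have := sub_smul_dslope k 0 w
    simp only [sub_zero, smul_eq_mul, hk0] at this
    rw [← this, hΛ]
    field_simp [hne w hw]
  -- Differentiate `k = w Λ k'` and divide by `k'`.
  have hode : ∀ w ∈ ball (0 : ℂ) 1,
      Λ w * (1 + w * k2 w / k1 w) + w * deriv Λ w = 1 := by
    intro w hw
    have hΛw := (hΛd.differentiableAt (isOpen_ball.mem_nhds hw)).hasDerivAt
    have h1 : HasDerivAt (fun w => w * Λ w * k1 w)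
        ((1 * Λ w + w * deriv Λ w) * k1 w + w * Λ w * k2 w) w :=
      ((hasDerivAt_id w).mul hΛw).mul (hk1 w hw)
    have h2 : HasDerivAt k ((1 * Λ w + w * deriv Λ w) * k1 w + w * Λ w * k2 w) w :=
      h1.congr_of_eventuallyEq (by
        filter_upwards [isOpen_ball.mem_nhds hw] with v hv using hfac v hv)
    have h3 := h2.unique (hk w hw)
    have := hne w hw
    field_simp
    linear_combination h3
  have hΛ0 : Λ 0 = 1 := by
    simp only [hΛ, dslope_same, (hk 0 h0).deriv]
    exact div_self (hne 0 h0)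
  refine ⟨Λ, hΛd, fun w hw => ⟨hfac w hw, ?_⟩⟩
  have hsub : closedBall (0 : ℂ) ‖w‖ ⊆ ball 0 1 := by
    intro v hv
    simp only [mem_closedBall, dist_zero_right, mem_ball] at *
    linarith
  obtain ⟨w₀, hw₀, hmin⟩ := (isCompact_closedBall (0 : ℂ) ‖w‖).exists_isMinOn ⟨w, by simp⟩
    ((Complex.continuous_re.comp_continuousOn (hΛd.continuousOn.mono hsub)))
  by_contra hcon
  have hle : (Λ w₀).re ≤ 0 := by
    have := hmin (show w ∈ closedBall (0 : ℂ) ‖w‖ by simp)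
    simp only [mem_ofPred_eq, Function.comp] at this
    linarith
  have hb := hsub hw₀
  obtain ⟨x, hx, hxe⟩ := exists_nonpos_eq_mul_deriv_of_forall_re_le
    (hΛd.differentiableAt (isOpen_ball.mem_nhds hb)).hasDerivAt (by
      intro v hv
      have : v ∈ closedBall (0 : ℂ) ‖w‖ := by
        simp only [mem_closedBall, dist_zero_right] at *
        linarith
      simpa using hmin this)
  have h1 := hode w₀ hb
  have hP := hpos w₀ hb
  set P := 1 + w₀ * k2 w₀ / k1 w₀
  have hPne : P ≠ 0 := by
    intro h
    simp [h] at hP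
  -- At the minimum point the equation reads `Λ P + x = 1` with `x ≤ 0`, so `Λ` is a positive
  -- multiple of `1 / P` and cannot have real part `≤ 0`.
  have h2 : Λ w₀ = ((1 - x : ℝ) : ℂ) * P⁻¹ := by
    rw [hxe] at h1
    field_simp
    push_cast
    linear_combination h1
  have h3 : 0 < (P⁻¹).re := by
    rw [Complex.inv_re]
    exact div_pos hP (Complex.normSq_pos.2 hPne)
  rw [h2, Complex.re_ofReal_mul] at hle
  nlinarith

/-- If `k` is convex with `k 0 = 0` and `N 0 = 0`, a bound for `N' / k'` is a bound for `N / k`. -/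
theorem norm_le_mul_norm_of_convex {k k1 k2 N N1 : ℂ → ℂ} {M : ℝ} (hk0 : k 0 = 0)
    (hk : ∀ w ∈ ball (0 : ℂ) 1, HasDerivAt k (k1 w) w)
    (hk1 : ∀ w ∈ ball (0 : ℂ) 1, HasDerivAt k1 (k2 w) w)
    (hne : ∀ w ∈ ball (0 : ℂ) 1, k1 w ≠ 0)
    (hpos : ∀ w ∈ ball (0 : ℂ) 1, 0 < (1 + w * k2 w / k1 w).re)
    (hN0 : N 0 = 0) (hN : ∀ w ∈ ball (0 : ℂ) 1, HasDerivAt N (N1 w) w)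
    (hbd : ∀ w ∈ ball (0 : ℂ) 1, ‖N1 w‖ ≤ M * ‖k1 w‖) {w : ℂ} (hw : w ∈ ball (0 : ℂ) 1) :
    ‖N w‖ ≤ M * ‖k w‖ := by
  obtain ⟨Λ, hΛd, hΛ⟩ := exists_re_pos_of_convex hk0 hk hk1 hne hpos
  have h0 : (0 : ℂ) ∈ ball (0 : ℂ) 1 := by simp
  have hNd : DifferentiableOn ℂ N (ball 0 1) :=
    fun w hw => (hN w hw).differentiableAt.differentiableWithinAt
  have hk1d : DifferentiableOn ℂ k1 (ball 0 1) :=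
    fun w hw => (hk1 w hw).differentiableAt.differentiableWithinAt
  have hΛne : ∀ w ∈ ball (0 : ℂ) 1, Λ w ≠ 0 := by
    intro w hw h
    simpa [h] using (hΛ w hw).2
  set G : ℂ → ℂ := fun w => dslope N 0 w / (Λ w * k1 w) with hG
  have hGd : DifferentiableOn ℂ G (ball 0 1) :=
    ((Complex.differentiableOn_dslope (isOpen_ball.mem_nhds h0)).2 hNd).div (hΛd.mul hk1d)
      fun w hw => mul_ne_zero (hΛne w hw) (hne w hw)
  have hfac : ∀ w ∈ ball (0 : ℂ) 1, N w = G w * k w := by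
    intro w hw
    have := sub_smul_dslope N 0 w
    simp only [sub_zero, smul_eq_mul, hN0] at this
    rw [← this, hG, (hΛ w hw).1]
    field_simp [hne w hw, hΛne w hw]
  -- Differentiate `N = G k` and substitute `k = w Λ k'`.
  have hode : ∀ w ∈ ball (0 : ℂ) 1, G w + w * deriv G w * Λ w = N1 w / k1 w := by
    intro w hw
    have hGw := (hGd.differentiableAt (isOpen_ball.mem_nhds hw)).hasDerivAt
    have h2 : HasDerivAt N (deriv G w * k w + G w * k1 w) w :=
      (hGw.mul (hk w hw)).congr_of_eventuallyEq (by
        filter_upwards [isOpen_ball.mem_nhds hw] with v hv using hfac v hv)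
    have h3 := h2.unique (hN w hw)
    rw [(hΛ w hw).1] at h3
    have := hne w hw
    field_simp
    linear_combination h3
  rw [hfac w hw, norm_mul]
  refine mul_le_mul_of_nonneg_right ?_ (norm_nonneg _)
  have hsub : closedBall (0 : ℂ) ‖w‖ ⊆ ball 0 1 := by
    intro v hv
    simp only [mem_closedBall, dist_zero_right, mem_ball] at *
    linarith
  obtain ⟨w₀, hw₀, hmax⟩ := (isCompact_closedBall (0 : ℂ) ‖w‖).exists_isMaxOn ⟨w, by simp⟩
    (hGd.continuousOn.mono hsub).norm
  have hb := hsub hw₀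
  refine (hmax (show w ∈ closedBall (0 : ℂ) ‖w‖ by simp)).trans ?_
  change ‖G w₀‖ ≤ M
  have hself : (conj (G w₀) * G w₀).re = ‖G w₀‖ ^ 2 := by
    rw [mul_comm, Complex.mul_conj, Complex.ofReal_re, Complex.normSq_eq_norm_sq]
  -- Where `|G|` is maximal, `Re (-conj (G w₀) G)` is minimal, so `conj (G w₀) w₀ G'(w₀) = -x ≥ 0`.
  -- The equation times `conj (G w₀)` then has real part at least `|G w₀|²`, since `Re Λ > 0`.
  obtain ⟨x, hx, hxe⟩ := exists_nonpos_eq_mul_deriv_of_forall_re_le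
    ((hGd.differentiableAt (isOpen_ball.mem_nhds hb)).hasDerivAt.const_mul (-conj (G w₀))) (by
      intro v hv
      have hv : v ∈ closedBall (0 : ℂ) ‖w‖ := by
        simp only [mem_closedBall, dist_zero_right] at *
        linarith
      have h1 : ‖G v‖ ≤ ‖G w₀‖ := hmax hv
      have h2 : (conj (G w₀) * G v).re ≤ ‖G w₀‖ * ‖G v‖ := by
        refine (Complex.re_le_norm _).trans ?_
        simp
      simp only [neg_mul, Complex.neg_re, hself]
      nlinarith [norm_nonneg (G w₀)])
  have h1 : conj (G w₀) * G w₀ + ((-x : ℝ) : ℂ) * Λ w₀ = conj (G w₀) * (N1 w₀ / k1 w₀) := by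
    rw [← hode w₀ hb]
    push_cast
    linear_combination (Λ w₀) * hxe
  have h2 : (conj (G w₀) * (N1 w₀ / k1 w₀)).re ≤ ‖G w₀‖ * M := by
    refine (Complex.re_le_norm _).trans ?_
    rw [norm_mul, norm_div, RCLike.norm_conj]
    refine mul_le_mul_of_nonneg_left ?_ (norm_nonneg _)
    exact (div_le_iff₀ (norm_pos_iff.2 (hne w₀ hb))).2 (hbd w₀ hb)
  rw [← h1, Complex.add_re, hself, Complex.re_ofReal_mul] at h2
  have hM : 0 ≤ M := by
    have := (norm_nonneg _).trans (hbd w₀ hb)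
    exact nonneg_of_mul_nonneg_left this (norm_pos_iff.2 (hne w₀ hb))
  have h3 := mul_nonneg (neg_nonneg.2 hx) (hΛ w₀ hb).2.le
  rcases (norm_nonneg (G w₀)).eq_or_lt with h | h
  · rw [← h]; exact hM
  · have : ‖G w₀‖ * ‖G w₀‖ ≤ ‖G w₀‖ * M := by nlinarith
    exact le_of_mul_le_mul_left this h

/-- If `1 + u Q(u)` has positive real part on the disk, then `Q = 2ω / (1 - uω)` with `|ω| ≤ 1`. -/
theorem exists_schwarz_function {Q : ℂ → ℂ} (hQ : DifferentiableOn ℂ Q (ball 0 1))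
    (hpos : ∀ u ∈ ball (0 : ℂ) 1, 0 < (1 + u * Q u).re) {u : ℂ} (hu : u ∈ ball (0 : ℂ) 1) :
    ∃ ω : ℂ, ‖ω‖ ≤ 1 ∧ Q u * (1 - u * ω) = 2 * ω := by
  have hne : ∀ u ∈ ball (0 : ℂ) 1, 2 + u * Q u ≠ 0 := by
    intro u hu h
    have := hpos u hu
    rw [show 1 + u * Q u = -1 by linear_combination h] at this
    norm_num at this
  -- With `p = 1 + u Q`, this is the Cayley transform `(p - 1) / (p + 1)`; it maps the disk into the
  -- closed unit disk and vanishes at `0`, so the Schwarz lemma bounds `S(u) / u`.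
  set S : ℂ → ℂ := fun u => u * (Q u / (2 + u * Q u)) with hS
  have hSd : DifferentiableOn ℂ S (ball 0 1) :=
    differentiableOn_id.mul (hQ.div ((differentiableOn_const _).add (differentiableOn_id.mul hQ))
      hne)
  have hS0 : S 0 = 0 := by simp [hS]
  have hmaps : MapsTo S (ball 0 1) (closedBall (S 0) 1) := by
    intro v hv
    rw [hS0, mem_closedBall_zero_iff, hS]
    simp only
    rw [← mul_div_assoc, norm_div, div_le_one (norm_pos_iff.2 (hne v hv)),
      ← sq_le_sq₀ (norm_nonneg _) (norm_nonneg _), ← Complex.normSq_eq_norm_sq,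
      ← Complex.normSq_eq_norm_sq, Complex.normSq_apply, Complex.normSq_apply]
    have := hpos v hv
    simp only [Complex.add_re, Complex.add_im, Complex.one_re, Complex.re_ofNat,
      Complex.im_ofNat] at *
    nlinarith
  have hslope : ∀ v ∈ ball (0 : ℂ) 1, v ≠ 0 → ‖Q v / (2 + v * Q v)‖ ≤ 1 := by
    intro v hv hv0
    have := Complex.norm_dslope_le_div_of_mapsTo_ball hSd hmaps hv
    rw [dslope_of_ne _ hv0, slope_def_field, hS0] at this
    simpa [hS, hv0] using this
  have hω : ‖Q u / (2 + u * Q u)‖ ≤ 1 := by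
    by_cases h0 : u = 0
    · have := Complex.norm_dslope_le_div_of_mapsTo_ball hSd hmaps hu
      rw [h0, dslope_same] at this
      have hd : HasDerivAt S (1 * (Q 0 / (2 + 0 * Q 0)) + 0 * deriv (fun u => Q u / (2 + u * Q u)) 0)
          0 := by
        refine (hasDerivAt_id (0 : ℂ)).mul (DifferentiableAt.hasDerivAt ?_)
        have h00 : (0 : ℂ) ∈ ball (0 : ℂ) 1 := by simp
        have hQ0 := hQ.differentiableAt (isOpen_ball.mem_nhds h00)
        exact hQ0.div ((differentiableAt_const _).add (differentiableAt_id.mul hQ0)) (hne 0 h00)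
      rw [hd.deriv] at this
      simpa [h0] using this
    · exact hslope u hu h0
  refine ⟨_, hω, ?_⟩
  have := div_mul_cancel₀ (Q u) (hne u hu)
  linear_combination -this

/-- Positivity of the real part of the Cayley transform. -/
theorem re_one_add_div_one_sub_pos {X : ℂ} (hX : ‖X‖ < 1) : 0 < ((1 + X) / (1 - X)).re := by
  have hne : 1 - X ≠ 0 := by
    intro h
    rw [← sub_eq_zero.1 h] at hX
    simp at hX
  have h2 : X.re * X.re + X.im * X.im < 1 := by
    rw [← Complex.normSq_apply, Complex.normSq_eq_norm_sq]
    nlinarith [norm_nonneg X]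
  rw [Complex.div_re, ← add_div]
  refine div_pos ?_ (Complex.normSq_pos.2 hne)
  simp only [Complex.add_re, Complex.sub_re, Complex.add_im, Complex.sub_im, Complex.one_re,
    Complex.one_im]
  nlinarith

/-- The difference of the squares of the two sides is `(1 - |ω|²)(1 - |ζ|²)`. -/
theorem norm_sub_le_norm_one_sub_mul {ω ζ : ℂ} (hω : ‖ω‖ ≤ 1) (hζ : ‖ζ‖ < 1) :
    ‖ω - conj ζ‖ ≤ ‖1 - ζ * ω‖ := by
  rw [← sq_le_sq₀ (norm_nonneg _) (norm_nonneg _), ← Complex.normSq_eq_norm_sq,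
    ← Complex.normSq_eq_norm_sq]
  have h1 : Complex.normSq ω ≤ 1 := by
    rw [Complex.normSq_eq_norm_sq]; nlinarith [norm_nonneg ω]
  have h2 : Complex.normSq ζ ≤ 1 := by
    rw [Complex.normSq_eq_norm_sq]; nlinarith [norm_nonneg ζ]
  simp only [Complex.normSq_apply, Complex.sub_re, Complex.sub_im, Complex.mul_re, Complex.mul_im,
    Complex.conj_re, Complex.conj_im, Complex.one_re, Complex.one_im] at *
  nlinarith [mul_nonneg (sub_nonneg.2 h1) (sub_nonneg.2 h2)]

theorem one_sub_mul_ne_zero {a b : ℂ} (ha : ‖a‖ ≤ 1) (hb : ‖b‖ < 1) : 1 - b * a ≠ 0 := by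
  intro h
  have h1 : ‖b * a‖ = 1 := by rw [← sub_eq_zero.1 h]; simp
  rw [norm_mul] at h1
  nlinarith [norm_nonneg a, norm_nonneg b]

/-- The disk automorphism `w ↦ (w + ζ) / (1 + conj ζ w)` maps the disk to itself. -/
theorem norm_add_div_lt_one {w ζ : ℂ} (hw : ‖w‖ < 1) (hζ : ‖ζ‖ < 1) :
    ‖(w + ζ) / (1 + conj ζ * w)‖ < 1 := by
  have hne : 1 + conj ζ * w ≠ 0 := by
    simpa using one_sub_mul_ne_zero (a := w) (b := -conj ζ) hw.le (by simpa using hζ)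
  rw [norm_div, div_lt_one (norm_pos_iff.2 hne), ← sq_lt_sq₀ (norm_nonneg _) (norm_nonneg _),
    ← Complex.normSq_eq_norm_sq, ← Complex.normSq_eq_norm_sq]
  have h1 : Complex.normSq w < 1 := by
    rw [Complex.normSq_eq_norm_sq]; nlinarith [norm_nonneg w]
  have h2 : Complex.normSq ζ < 1 := by
    rw [Complex.normSq_eq_norm_sq]; nlinarith [norm_nonneg ζ]
  simp only [Complex.normSq_apply, Complex.add_re, Complex.add_im, Complex.mul_re, Complex.mul_im,
    Complex.conj_re, Complex.conj_im, Complex.one_re, Complex.one_im] at *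
  nlinarith [mul_pos (sub_pos.2 h1) (sub_pos.2 h2)]

/-- For `h` convex on the disk, a bound for `N' / h'` bounds the ratio of the increments of
`N` and `h`. -/
theorem norm_sub_le_mul_norm_sub_of_convex {h h1 h2 N N1 : ℂ → ℂ} {M : ℝ}
    (hh : ∀ w ∈ ball (0 : ℂ) 1, HasDerivAt h (h1 w) w)
    (hh1 : ∀ w ∈ ball (0 : ℂ) 1, HasDerivAt h1 (h2 w) w)
    (hh2 : DifferentiableOn ℂ h2 (ball 0 1))
    (hne : ∀ w ∈ ball (0 : ℂ) 1, h1 w ≠ 0)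
    (hpos : ∀ w ∈ ball (0 : ℂ) 1, 0 < (1 + w * h2 w / h1 w).re)
    (hN : ∀ w ∈ ball (0 : ℂ) 1, HasDerivAt N (N1 w) w)
    (hbd : ∀ w ∈ ball (0 : ℂ) 1, ‖N1 w‖ ≤ M * ‖h1 w‖) {z ζ : ℂ} (hz : z ∈ ball (0 : ℂ) 1)
    (hζ : ζ ∈ ball (0 : ℂ) 1) :
    ‖N z - N ζ‖ ≤ M * ‖h z - h ζ‖ := by
  rw [mem_ball_zero_iff] at hz hζ
  have hden : ∀ w ∈ ball (0 : ℂ) 1, 1 + conj ζ * w ≠ 0 := by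
    intro w hw
    rw [mem_ball_zero_iff] at hw
    simpa using one_sub_mul_ne_zero (a := w) (b := -conj ζ) hw.le (by simpa using hζ)
  set τ : ℂ → ℂ := fun w => (w + ζ) / (1 + conj ζ * w) with hτ
  have hτb : ∀ w ∈ ball (0 : ℂ) 1, τ w ∈ ball (0 : ℂ) 1 := by
    intro w hw
    rw [mem_ball_zero_iff] at *
    exact norm_add_div_lt_one hw hζ
  set τ1 : ℂ → ℂ := fun w => (1 - conj ζ * ζ) / (1 + conj ζ * w) ^ 2 with hτ1
  set τ2 : ℂ → ℂ := fun w => τ1 w * (-2 * conj ζ / (1 + conj ζ * w)) with hτ2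
  have hlin : ∀ w : ℂ, HasDerivAt (fun w => 1 + conj ζ * w) (conj ζ) w := fun w => by
    simpa using ((hasDerivAt_id w).const_mul (conj ζ)).const_add 1
  have hτd : ∀ w ∈ ball (0 : ℂ) 1, HasDerivAt τ (τ1 w) w := by
    intro w hw
    refine (((hasDerivAt_id w).add_const ζ).div (hlin w) (hden w hw)).congr_deriv ?_
    simp only [hτ1, id]
    congr 1
    ring
  have hτ1d : ∀ w ∈ ball (0 : ℂ) 1, HasDerivAt τ1 (τ2 w) w := by
    intro w hw
    refine ((hasDerivAt_const w (1 - conj ζ * ζ)).div ((hlin w).pow 2)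
      (pow_ne_zero 2 (hden w hw))).congr_deriv ?_
    have := hden w hw
    simp only [hτ2, hτ1, Pi.pow_apply]
    field_simp
    ring
  have hζζ : 1 - conj ζ * ζ ≠ 0 := by
    simpa using one_sub_mul_ne_zero (a := ζ) (b := conj ζ) hζ.le (by simpa using hζ)
  have hτ1ne : ∀ w ∈ ball (0 : ℂ) 1, τ1 w ≠ 0 := fun w hw =>
    div_ne_zero hζζ (pow_ne_zero 2 (hden w hw))
  have hτ0 : τ 0 = ζ := by simp [hτ]
  -- The automorphism `τ` carries `0` to `ζ`, which reduces two points to the one-point comparison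
  -- at the origin. What remains is that `h ∘ τ` is again convex.
  have key := norm_le_mul_norm_of_convex
    (k := fun w => h (τ w) - h ζ) (k1 := fun w => h1 (τ w) * τ1 w)
    (k2 := fun w => h2 (τ w) * τ1 w * τ1 w + h1 (τ w) * τ2 w)
    (N := fun w => N (τ w) - N ζ) (N1 := fun w => N1 (τ w) * τ1 w) (M := M)
    (by simp [hτ0])
    (fun w hw => ((hh _ (hτb w hw)).comp w (hτd w hw)).sub_const _)
    (fun w hw => ((hh1 _ (hτb w hw)).comp w (hτd w hw)).mul (hτ1d w hw))
    (fun w hw => mul_ne_zero (hne _ (hτb w hw)) (hτ1ne w hw))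
    ?_ (by simp [hτ0])
    (fun w hw => ((hN _ (hτb w hw)).comp w (hτd w hw)).sub_const _)
    (fun w hw => by
      rw [norm_mul, norm_mul, ← mul_assoc]
      exact mul_le_mul_of_nonneg_right (hbd _ (hτb w hw)) (norm_nonneg _))
    (w := (z + -ζ) / (1 + conj (-ζ) * z))
    (by
      rw [mem_ball_zero_iff]
      exact norm_add_div_lt_one hz (by simpa using hζ))
  · have hinv : τ ((z + -ζ) / (1 + conj (-ζ) * z)) = z := by
      have hd : 1 - conj ζ * z ≠ 0 :=
        one_sub_mul_ne_zero (a := z) (b := conj ζ) hz.le (by simpa using hζ)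
      have hd2 : 1 - conj ζ * z + conj ζ * (z - ζ) ≠ 0 := by
        rw [show 1 - conj ζ * z + conj ζ * (z - ζ) = 1 - conj ζ * ζ by ring]
        exact hζζ
      simp only [hτ, map_neg, neg_mul, ← sub_eq_add_neg]
      rw [div_add' _ _ _ hd, mul_div_assoc', one_add_div hd, div_div_div_cancel_right₀ hd,
        div_eq_iff hd2]
      ring
    simpa only [hinv] using key
  · intro w hw
    have hb := hτb w hw
    have hh1d : DifferentiableOn ℂ h1 (ball 0 1) :=
      fun w hw => (hh1 w hw).differentiableAt.differentiableWithinAt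
    obtain ⟨ω, hω, hωe⟩ := exists_schwarz_function (hh2.div hh1d hne)
      (fun u hu => by simpa [mul_div_assoc] using hpos u hu) hb
    have hd1 : 1 - ζ * ω ≠ 0 := one_sub_mul_ne_zero hω hζ
    have hd0 := hden w hw
    have hdτ : 1 - τ w * ω ≠ 0 := one_sub_mul_ne_zero hω (by simpa using hb)
    rw [mem_ball_zero_iff] at hw
    have hΩ : ‖(ω - conj ζ) / (1 - ζ * ω)‖ ≤ 1 := by
      rw [norm_div, div_le_one (norm_pos_iff.2 hd1)]
      exact norm_sub_le_norm_one_sub_mul hω hζ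
    -- `h''/h' = 2ω / (1 - τω)` turns the convexity quotient of `h ∘ τ` into `(1 + X) / (1 - X)`,
    -- where `|X| < 1`.
    set X := w * ((ω - conj ζ) / (1 - ζ * ω)) with hX
    have hdX : 1 - X ≠ 0 := one_sub_mul_ne_zero hΩ hw
    have hXlt : ‖X‖ < 1 := by
      rw [hX, norm_mul]
      nlinarith [norm_nonneg w, norm_nonneg ((ω - conj ζ) / (1 - ζ * ω))]
    convert re_one_add_div_one_sub_pos hXlt using 2
    have h1ne := hne _ hb
    have hq : h2 (τ w) / h1 (τ w) = 2 * ω / (1 - τ w * ω) := by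
      rw [eq_div_iff hdτ]
      exact hωe
    have hXD : X * (1 - ζ * ω) = w * (ω - conj ζ) := by
      rw [hX, mul_assoc, div_mul_cancel₀ _ hd1]
    have hd4 : 1 - ζ * ω - w * (ω - conj ζ) ≠ 0 := by
      rw [← hXD, show 1 - ζ * ω - X * (1 - ζ * ω) = (1 - ζ * ω) * (1 - X) by ring]
      exact mul_ne_zero hd1 hdX
    have hτω : 1 - τ w * ω = (1 - ζ * ω - w * (ω - conj ζ)) / (1 + conj ζ * w) := by
      rw [eq_div_iff hd0]
      linear_combination -ω * div_mul_cancel₀ (w + ζ) hd0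
    have hdX' : (1 + X) / (1 - X) =
        (1 - ζ * ω + w * (ω - conj ζ)) / (1 - ζ * ω - w * (ω - conj ζ)) := by
      rw [div_eq_div_iff hdX hd4]
      linear_combination 2 * hXD
    have hlhs : 1 + w * (h2 (τ w) * τ1 w * τ1 w + h1 (τ w) * τ2 w) / (h1 (τ w) * τ1 w) =
        1 + w * (h2 (τ w) / h1 (τ w) * τ1 w + -2 * conj ζ / (1 + conj ζ * w)) := by
      have := hτ1ne w (by simpa using hw)
      simp only [hτ2]
      field_simp
    rw [hlhs, hq, hτω, hdX']
    simp only [hτ1]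
    obtain ⟨B, hB⟩ : ∃ B, B = 1 + conj ζ * w := ⟨_, rfl⟩
    obtain ⟨E, hE⟩ : ∃ E, E = 1 - ζ * ω - w * (ω - conj ζ) := ⟨_, rfl⟩
    rw [← hB] at hd0 ⊢
    rw [← hE] at hd4 ⊢
    field_simp
    rw [hB, hE]
    ring

/-! ### Distortion of convex functions of given order -/

/-- Lower distortion bound for the derivative of a convex function of order `1 - β`. -/
theorem rpow_neg_le_norm_of_order {h1 h2 : ℂ → ℂ} {β : ℝ} (hβ : 0 < β)
    (hh1 : ∀ w ∈ ball (0 : ℂ) 1, HasDerivAt h1 (h2 w) w)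
    (hh2 : DifferentiableOn ℂ h2 (ball 0 1))
    (hne : ∀ w ∈ ball (0 : ℂ) 1, h1 w ≠ 0) (h10 : h1 0 = 1)
    (hpos : ∀ w ∈ ball (0 : ℂ) 1, 1 - β < (1 + w * h2 w / h1 w).re)
    {z : ℂ} (hz : z ∈ ball (0 : ℂ) 1) :
    (1 + ‖z‖) ^ (-(2 * β)) ≤ ‖h1 z‖ := by
  rw [mem_ball_zero_iff] at hz
  obtain ⟨e, he, hze⟩ : ∃ e : ℂ, ‖e‖ = 1 ∧ z = (‖z‖ : ℂ) * e := by
    by_cases h0 : z = 0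
    · exact ⟨1, by simp, by simp [h0]⟩
    · refine ⟨z / ‖z‖, ?_, ?_⟩
      · simp [h0]
      · have : (‖z‖ : ℂ) ≠ 0 := by simpa using h0
        field_simp
  have hh1d : DifferentiableOn ℂ h1 (ball 0 1) :=
    fun w hw => (hh1 w hw).differentiableAt.differentiableWithinAt
  have hmem : ∀ t ∈ Icc (0 : ℝ) ‖z‖, (t : ℂ) * e ∈ ball (0 : ℂ) 1 := by
    intro t ht
    rw [mem_ball_zero_iff, norm_mul, he, mul_one, Complex.norm_real, Real.norm_eq_abs,
      abs_of_nonneg ht.1]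
    exact ht.2.trans_lt hz
  -- The squared claim along the ray through `z`: `F(0) = 1`, so it is enough that `F` increases.
  set F : ℝ → ℝ := fun t => ‖h1 (t * e)‖ ^ 2 * (1 + t) ^ (4 * β) with hF
  set F' : ℝ → ℝ := fun t => 2 * inner ℝ (h1 (t * e)) (h2 (t * e) * e) * (1 + t) ^ (4 * β) +
    ‖h1 (t * e)‖ ^ 2 * (4 * β * (1 + t) ^ (4 * β - 1)) with hF'
  have hder : ∀ t ∈ Icc (0 : ℝ) ‖z‖, HasDerivAt F (F' t) t := by
    intro t ht
    have h1 : HasDerivAt (fun t : ℝ => h1 (t * e)) (h2 (t * e) * e) t := by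
      have hl : HasDerivAt (fun t : ℝ => (t : ℂ) * e) e t := by
        simpa using ((hasDerivAt_id t).ofReal_comp).mul_const e
      exact (hh1 _ (hmem t ht)).comp t hl
    have h2 : HasDerivAt (fun t : ℝ => (1 + t) ^ (4 * β)) (4 * β * (1 + t) ^ (4 * β - 1)) t := by
      have := ((hasDerivAt_id t).const_add 1).rpow_const (p := 4 * β)
        (Or.inl (by simp only [id]; linarith [ht.1]))
      simpa using this
    exact h1.norm_sq.mul h2
  have hmono : MonotoneOn F (Icc 0 ‖z‖) := by
    refine monotoneOn_of_deriv_nonneg (convex_Icc _ _)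
      (fun t ht => (hder t ht).continuousAt.continuousWithinAt)
      (fun t ht => (hder t (interior_subset ht)).differentiableAt.differentiableWithinAt) ?_
    intro t ht
    have ht := interior_subset ht
    rw [(hder t ht).deriv]
    have hb := hmem t ht
    obtain ⟨ω, hω, hωe⟩ := exists_schwarz_function (Q := fun u => h2 u / h1 u / β)
      ((hh2.div hh1d hne).div_const _) (fun u hu => by
        have := hpos u hu
        rw [show 1 + u * (h2 u / h1 u / β) = 1 + ((1 / β : ℝ) : ℂ) * (u * h2 u / h1 u) by
          push_cast; ring, Complex.add_re, Complex.re_ofReal_mul]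
        rw [Complex.add_re, Complex.one_re] at *
        have h3 : -β < (u * h2 u / h1 u).re := by linarith
        have : -1 < 1 / β * (u * h2 u / h1 u).re := by
          rw [one_div, ← div_eq_inv_mul, lt_div_iff₀ hβ]
          linarith
        linarith) hb
    have ht1 : ‖(t : ℂ) * e‖ < 1 := by simpa using hb
    have hd := one_sub_mul_ne_zero hω ht1
    have hv : ‖e * ω‖ ≤ 1 := by rw [norm_mul, he, one_mul]; exact hω
    set v := e * ω with hvdef
    have hd' : 1 - (t : ℂ) * v ≠ 0 := by rwa [hvdef, ← mul_assoc]
    have hβ' : (β : ℂ) ≠ 0 := by exact_mod_cast hβ.ne'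
    have h1ne := hne _ hb
    have hquot : h2 (t * e) * e = h1 (t * e) * ((2 * β : ℝ) * (v / (1 - t * v))) := by
      have : h2 (t * e) / h1 (t * e) / β = 2 * ω / (1 - t * e * ω) := by
        rw [eq_div_iff hd]; exact hωe
      have h3 : h2 (t * e) = h1 (t * e) * β * (2 * ω / (1 - t * e * ω)) := by
        rw [← this]; field_simp
      rw [h3, hvdef, ← mul_assoc (t : ℂ)]
      push_cast
      ring
    -- After clearing the denominator this is `(1 - t)(1 + Re v) + t (1 - |v|²) ≥ 0`.
    have hre : -1 ≤ (1 + t) * (v / (1 - t * v)).re := by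
      have h4 : v.re * v.re + v.im * v.im ≤ 1 := by
        rw [← Complex.normSq_apply, Complex.normSq_eq_norm_sq]
        nlinarith [norm_nonneg v]
      rw [Complex.div_re, ← add_div, mul_div_assoc', le_div_iff₀ (Complex.normSq_pos.2 hd')]
      simp only [Complex.normSq_apply, Complex.sub_re, Complex.sub_im, Complex.one_re,
        Complex.one_im, Complex.re_ofReal_mul, Complex.im_ofReal_mul]
      have h5 : -1 ≤ v.re := by nlinarith [mul_self_nonneg v.im]
      have h6 : t < 1 := ht.2.trans_lt hz
      nlinarith [mul_nonneg ht.1 (sub_nonneg.2 h4), mul_nonneg (sub_nonneg.2 h6.le)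
        (by linarith : 0 ≤ 1 + v.re)]
    have hinner : inner ℝ (h1 (t * e)) (h2 (t * e) * e) =
        ‖h1 (t * e)‖ ^ 2 * (2 * β * (v / (1 - t * v)).re) := by
      rw [Complex.inner, hquot, mul_right_comm, Complex.mul_conj, Complex.re_ofReal_mul,
        Complex.re_ofReal_mul, Complex.normSq_eq_norm_sq]
    have ht0 : (0 : ℝ) < 1 + t := by linarith [ht.1]
    have hpow : (1 + t) ^ (4 * β) = (1 + t) ^ (4 * β - 1) * (1 + t) := by
      rw [← Real.rpow_add_one ht0.ne']; congr 1; ring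
    rw [hF']
    simp only
    rw [hinner, hpow]
    have hp : 0 ≤ ‖h1 (t * e)‖ ^ 2 * (4 * β) * (1 + t) ^ (4 * β - 1) := by positivity
    nlinarith [mul_nonneg hp (by linarith : 0 ≤ 1 + (1 + t) * (v / (1 - t * v)).re)]
  have hfin := hmono (left_mem_Icc.2 (norm_nonneg z)) (right_mem_Icc.2 (norm_nonneg z))
    (norm_nonneg z)
  simp only [hF, ← hze, Complex.ofReal_zero, zero_mul, h10, norm_one, one_pow, add_zero,
    Real.one_rpow, mul_one] at hfin
  have hp : (0 : ℝ) < 1 + ‖z‖ := by linarith [norm_nonneg z]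
  rw [Real.rpow_neg hp.le, inv_le_iff_one_le_mul₀ (by positivity),
    ← abs_of_nonneg (by positivity : 0 ≤ ‖h1 z‖ * (1 + ‖z‖) ^ (2 * β)), ← one_le_sq_iff_one_le_abs,
    mul_pow, ← Real.rpow_natCast ((1 + ‖z‖) ^ (2 * β)), ← Real.rpow_mul hp.le]
  convert hfin using 3
  push_cast
  ring

/-! ### Taylor coefficients and the sharp coefficient bound -/

theorem taylorCoeff_congr {φ ψ : ℂ → ℂ} (h : φ =ᶠ[𝓝 0] ψ) (k : ℕ) :
    taylorCoeff φ k = taylorCoeff ψ k := by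
  rw [taylorCoeff, taylorCoeff, h.iteratedDeriv_eq k]

theorem taylorCoeff_deriv (φ : ℂ → ℂ) (k : ℕ) :
    taylorCoeff (deriv φ) k = (k + 1) * taylorCoeff φ (k + 1) := by
  have h1 : (k.factorial : ℂ) ≠ 0 := by exact_mod_cast k.factorial_ne_zero
  have h2 : (k + 1 : ℂ) ≠ 0 := by exact_mod_cast k.succ_ne_zero
  rw [taylorCoeff, taylorCoeff, iteratedDeriv_succ', Nat.factorial_succ]
  push_cast
  field_simp

theorem taylorCoeff_const_mul (c : ℂ) (φ : ℂ → ℂ) (k : ℕ) :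
    taylorCoeff (fun z => c * φ z) k = c * taylorCoeff φ k := by
  rw [taylorCoeff, taylorCoeff, iteratedDeriv_const_mul_field, mul_div_assoc]

theorem taylorCoeff_mul {φ ψ : ℂ → ℂ} (hφ : AnalyticAt ℂ φ 0) (hψ : AnalyticAt ℂ ψ 0) (k : ℕ) :
    taylorCoeff (φ * ψ) k =
      ∑ i ∈ Finset.range (k + 1), taylorCoeff φ i * taylorCoeff ψ (k - i) := by
  rw [taylorCoeff, iteratedDeriv_mul hφ.contDiffAt hψ.contDiffAt, Finset.sum_div]
  refine Finset.sum_congr rfl fun i hi => ?_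
  have hi := Nat.lt_succ_iff.1 (Finset.mem_range.1 hi)
  have h1 : (k.factorial : ℂ) ≠ 0 := by exact_mod_cast k.factorial_ne_zero
  have h2 : (i.factorial : ℂ) ≠ 0 := by exact_mod_cast i.factorial_ne_zero
  have h3 : ((k - i).factorial : ℂ) ≠ 0 := by exact_mod_cast (k - i).factorial_ne_zero
  have h4 : (k.choose i : ℂ) * i.factorial * (k - i).factorial = k.factorial := by
    exact_mod_cast Nat.choose_mul_factorial_mul_factorial hi
  rw [taylorCoeff, taylorCoeff]
  field_simp
  linear_combination (iteratedDeriv i φ 0 * iteratedDeriv (k - i) ψ 0) * h4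

theorem taylorCoeff_id (k : ℕ) : taylorCoeff (fun z => z) k = if k = 1 then 1 else 0 := by
  rw [taylorCoeff]
  match k with
  | 0 => simp
  | 1 => simp [iteratedDeriv_one]
  | k + 2 =>
    rw [iteratedDeriv_succ']
    simp [iteratedDeriv_const]

theorem taylorCoeff_id_mul_succ {φ : ℂ → ℂ} (hφ : AnalyticAt ℂ φ 0) (k : ℕ) :
    taylorCoeff (fun z => z * φ z) (k + 1) = taylorCoeff φ k := by
  have he : (fun z => z * φ z) = (fun z : ℂ => z) * φ := by
    funext z
    simp
  have h := taylorCoeff_mul (φ := fun z : ℂ => z) analyticAt_id hφ (k + 1)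
  rw [Finset.sum_eq_single 1] at h
  · rw [he, h, taylorCoeff_id, if_pos rfl, one_mul, Nat.add_sub_cancel]
  · intro b _ hb
    simp [taylorCoeff_id, hb]
  · intro h
    simp at h

/-- The Cauchy integral formula for Taylor coefficients. -/
theorem circleAverage_inv_pow_mul {p : ℂ → ℂ} (hp : DifferentiableOn ℂ p (ball 0 1)) {R : ℝ}
    (hR0 : 0 < R) (hR1 : R < 1) (N : ℕ) :
    Real.circleAverage (fun z => (z ^ N)⁻¹ * p z) 0 R = taylorCoeff p N := by
  have hd : DiffContOnCl ℂ p (ball 0 R) :=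
    (hp.mono (closedBall_subset_ball hR1)).diffContOnCl_ball subset_rfl
  have := DiffContOnCl.circleIntegral_one_div_sub_center_pow_smul hR0 N hd
  rw [Real.circleAverage_eq_circleIntegral hR0.ne', taylorCoeff]
  have h2 : (∮ z in C(0, R), (z - 0)⁻¹ • ((z ^ N)⁻¹ * p z)) =
      ∮ z in C(0, R), (1 / (z - 0) ^ (N + 1)) • p z := by
    congr 1
    funext z
    simp only [sub_zero, smul_eq_mul, pow_succ, one_div, mul_inv]
    ring
  rw [h2, this, smul_eq_mul, smul_eq_mul]
  have : (Real.pi : ℂ) ≠ 0 := by exact_mod_cast Real.pi_ne_zero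
  field_simp [Complex.I_ne_zero]

/-- Carathéodory's coefficient bound for functions with positive real part. -/
theorem norm_taylorCoeff_le_two_mul_re {p : ℂ → ℂ} (hp : DifferentiableOn ℂ p (ball 0 1))
    (hpos : ∀ z ∈ ball (0 : ℂ) 1, 0 < (p z).re) {N : ℕ} (hN : N ≠ 0) :
    ‖taylorCoeff p N‖ ≤ 2 * (p 0).re := by
  -- A unimodular factor that turns the coefficient onto the negative real axis.
  obtain ⟨c, hc, hcp⟩ : ∃ c : ℂ, ‖c‖ = 1 ∧ c * taylorCoeff p N = -(‖taylorCoeff p N‖ : ℂ) := by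
    by_cases h0 : taylorCoeff p N = 0
    · exact ⟨1, by simp, by simp [h0]⟩
    · have h1 : (‖taylorCoeff p N‖ : ℂ) ≠ 0 := by simpa using h0
      refine ⟨-(conj (taylorCoeff p N) / ‖taylorCoeff p N‖), ?_, ?_⟩
      · simp [h0]
      · rw [neg_mul, div_mul_eq_mul_div, mul_comm (conj _), Complex.mul_conj,
          Complex.normSq_eq_norm_sq]
        push_cast
        field_simp
  have key : ∀ R ∈ Ioo (0 : ℝ) 1, R ^ N * ‖taylorCoeff p N‖ ≤ 2 * (p 0).re := by
    intro R hR
    have hsub : sphere (0 : ℂ) R ⊆ ball 0 1 := fun z hz => by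
      rw [mem_sphere_zero_iff_norm] at hz
      rw [mem_ball_zero_iff, hz]
      exact hR.2
    have hne : ∀ z ∈ sphere (0 : ℂ) R, z ^ N ≠ 0 := fun z hz => by
      rw [mem_sphere_zero_iff_norm] at hz
      refine pow_ne_zero _ (norm_pos_iff.1 ?_)
      rw [hz]
      exact hR.1
    have hpc : ContinuousOn p (sphere 0 R) := hp.continuousOn.mono hsub
    have hzc : ContinuousOn (fun z : ℂ => z ^ N) (sphere 0 R) := (continuous_pow N).continuousOn
    have hR0 : (R : ℂ) ≠ 0 := by exact_mod_cast hR.1.ne'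
    have hi1 : CircleIntegrable (fun z => 2 * p z) 0 R :=
      (continuousOn_const.mul hpc).circleIntegrable hR.1.le
    have hi2 : CircleIntegrable (fun z => (c * R ^ N) • ((z ^ N)⁻¹ * p z)) 0 R :=
      (continuousOn_const.mul ((hzc.inv₀ hne).mul hpc)).circleIntegrable hR.1.le
    have hi3 : CircleIntegrable (fun z => (conj c / R ^ N) • (z ^ N * p z)) 0 R :=
      (continuousOn_const.mul (hzc.mul hpc)).circleIntegrable hR.1.le
    have habs : |R| < 1 := by rw [abs_of_pos hR.1]; exact hR.2
    have hmean : ∀ q : ℂ → ℂ, DifferentiableOn ℂ q (ball 0 1) →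
        Real.circleAverage q 0 R = q 0 := fun q hq =>
      DiffContOnCl.circleAverage
        ((hq.mono (closedBall_subset_ball habs)).diffContOnCl_ball subset_rfl)
    have ha1 : Real.circleAverage (fun z => 2 * p z) 0 R = 2 * p 0 :=
      hmean _ ((differentiableOn_const _).mul hp)
    have ha2 : Real.circleAverage (fun z => (c * R ^ N) • ((z ^ N)⁻¹ * p z)) 0 R =
        c * R ^ N * taylorCoeff p N := by
      rw [Real.circleAverage_fun_smul, circleAverage_inv_pow_mul hp hR.1 hR.2, smul_eq_mul]
    have ha3 : Real.circleAverage (fun z => (conj c / R ^ N) • (z ^ N * p z)) 0 R = 0 := by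
      rw [Real.circleAverage_fun_smul, hmean (fun z => z ^ N * p z)
        ((differentiableOn_id.pow N).mul hp)]
      simp [hN]
    have hsum := Real.circleAverage_fun_add (hi1.add hi2) hi3
    rw [ha3, add_zero] at hsum
    have hsum2 := Real.circleAverage_fun_add hi1 hi2
    rw [ha1, ha2] at hsum2
    have hre := Complex.reCLM.circleAverage_comp_comm ((hi1.add hi2).add hi3)
    -- On `|z| = R` the three terms add up to `(2 + 2 Re X) p` with `|X| = 1`, so the real part is
    -- nonnegative. By Cauchy's formula their mean is `2 p(0) + c R^N a_N`, because the third term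
    -- has mean zero.
    have hnonneg : 0 ≤ Real.circleAverage (Complex.reCLM ∘ ((fun z => 2 * p z) +
        (fun z => (c * R ^ N) • ((z ^ N)⁻¹ * p z)) +
        fun z => (conj c / R ^ N) • (z ^ N * p z))) 0 R := by
      refine Real.circleAverage_nonneg_of_nonneg fun z hz => ?_
      rw [abs_of_pos hR.1] at hz
      set X := c * R ^ N * (z ^ N)⁻¹ with hX
      have hXn : ‖X‖ = 1 := by
        have hzn : ‖z‖ = R := mem_sphere_zero_iff_norm.1 hz
        have : R ^ N ≠ 0 := pow_ne_zero _ hR.1.ne'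
        rw [hX, norm_mul, norm_mul, norm_inv, norm_pow, norm_pow, hzn, hc, Complex.norm_real,
          Real.norm_eq_abs, abs_of_pos hR.1]
        field_simp
      have hXc : conj c / R ^ N * z ^ N = conj X := by
        have h1 : X * conj X = 1 := by
          rw [Complex.mul_conj, Complex.normSq_eq_norm_sq, hXn]; simp
        have h2 : X * (conj c / R ^ N * z ^ N) = 1 := by
          have h3 : c * conj c = 1 := by
            rw [Complex.mul_conj, Complex.normSq_eq_norm_sq, hc]; simp
          have h4 := hne z hz
          rw [hX]
          field_simp
          exact h3
        have hX0 : X ≠ 0 := by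
          rw [← norm_pos_iff, hXn]; exact one_pos
        exact mul_left_cancel₀ hX0 (h2.trans h1.symm)
      have hval : 2 * p z + (c * R ^ N) • ((z ^ N)⁻¹ * p z) + (conj c / R ^ N) • (z ^ N * p z) =
          ((2 + 2 * X.re : ℝ) : ℂ) * p z := by
        have h5 : X + conj X = ((2 * X.re : ℝ) : ℂ) := Complex.add_conj X
        rw [Complex.ofReal_add, ← h5, ← hXc, hX, smul_eq_mul, smul_eq_mul]
        push_cast
        ring
      simp only [Function.comp, Pi.add_apply, Complex.reCLM_apply]
      rw [hval, Complex.re_ofReal_mul]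
      have h6 : -1 ≤ X.re := by
        have := Complex.abs_re_le_norm X
        rw [hXn] at this
        exact (abs_le.1 this).1
      exact mul_nonneg (by linarith) (hpos z (hsub hz)).le
    rw [hre] at hnonneg
    have hfin : Real.circleAverage ((fun z => 2 * p z) +
        (fun z => (c * R ^ N) • ((z ^ N)⁻¹ * p z)) +
        fun z => (conj c / R ^ N) • (z ^ N * p z)) 0 R =
        2 * p 0 + c * R ^ N * taylorCoeff p N := hsum.trans hsum2
    rw [hfin, Complex.reCLM_apply, mul_right_comm, hcp, Complex.add_re,
      show -(‖taylorCoeff p N‖ : ℂ) * (R : ℂ) ^ N =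
        ((-(‖taylorCoeff p N‖ * R ^ N) : ℝ) : ℂ) by push_cast; ring, Complex.ofReal_re] at hnonneg
    have h7 : (2 * p 0).re = 2 * (p 0).re := by simp
    rw [h7] at hnonneg
    linarith
  have hlim : Tendsto (fun R : ℝ => R ^ N * ‖taylorCoeff p N‖) (𝓝[<] 1)
      (𝓝 ((1 : ℝ) ^ N * ‖taylorCoeff p N‖)) :=
    ((continuous_pow N).mul continuous_const).continuousAt.mono_left nhdsWithin_le_nhds
  rw [one_pow, one_mul] at hlim
  exact le_of_tendsto hlim (by
    filter_upwards [Ioo_mem_nhdsLT zero_lt_one] with R hR using key R hR)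

theorem coeffBound_one (α : ℝ) : coeffBound 1 α = 1 := by simp [coeffBound]

theorem succ_mul_coeffBound_succ {k : ℕ} (hk : 1 ≤ k) (α : ℝ) :
    (k + 1) * coeffBound (k + 1) α = (k + 1 - 2 * α) * coeffBound k α := by
  have h1 : (k.factorial : ℝ) ≠ 0 := by exact_mod_cast k.factorial_ne_zero
  have h2 : (k + 1 : ℝ) ≠ 0 := by exact_mod_cast k.succ_ne_zero
  rw [coeffBound, coeffBound, Finset.prod_Icc_succ_top (by omega), Nat.factorial_succ]
  push_cast
  field_simp

theorem coeffBound_nonneg {α : ℝ} (hα1 : α < 1) (k : ℕ) : 0 ≤ coeffBound k α := by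
  refine mul_nonneg (by positivity) (Finset.prod_nonneg fun j hj => ?_)
  have : (2 : ℝ) ≤ j := by exact_mod_cast (Finset.mem_Icc.1 hj).1
  linarith

theorem coeffBound_pos {α : ℝ} (hα1 : α < 1) (k : ℕ) : 0 < coeffBound k α := by
  refine mul_pos (by positivity) (Finset.prod_pos fun j hj => ?_)
  have : (2 : ℝ) ≤ j := by exact_mod_cast (Finset.mem_Icc.1 hj).1
  linarith

/-- With `Q = h''/h'`, the identity `h'' = h' Q` and `|q_j| ≤ 2(1 - α)` give a recursive bound for
the coefficients of `h'`. The numbers `(k + 1) A_{k+1}` satisfy that recursion with equality, so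
induction closes on them exactly. -/
theorem sum_mul_coeffBound (α : ℝ) (k : ℕ) :
    2 * (1 - α) * ∑ i ∈ Finset.range (k + 1), ((i : ℝ) + 1) * coeffBound (i + 1) α =
      (k + 1) * ((k + 2) * coeffBound (k + 2) α) := by
  induction k with
  | zero =>
    have := succ_mul_coeffBound_succ le_rfl α
    simp only [Nat.cast_one, coeffBound_one, one_add_one_eq_two] at this
    simp [coeffBound_one]
    linarith
  | succ k ih =>
    rw [Finset.sum_range_succ, mul_add, ih]
    have h := succ_mul_coeffBound_succ (k := k + 2) (by omega) α
    push_cast at h ⊢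
    rw [show (k : ℝ) + 1 + 2 = k + 2 + 1 by ring, show k + 1 + 2 = k + 2 + 1 by ring, h]
    ring_nf

/-- The Taylor coefficients of a convex function of order `α`. -/
theorem norm_taylorCoeff_le_coeffBound {h : ℂ → ℂ} {α : ℝ} (hα1 : α < 1)
    (hh : DifferentiableOn ℂ h (ball 0 1)) (hd0 : deriv h 0 = 1)
    (hne : ∀ z ∈ ball (0 : ℂ) 1, deriv h z ≠ 0)
    (hord : ∀ z ∈ ball (0 : ℂ) 1, α < (1 + z * deriv (deriv h) z / deriv h z).re) (k : ℕ) :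
    ‖taylorCoeff h (k + 1)‖ ≤ coeffBound (k + 1) α := by
  have h0 : ball (0 : ℂ) 1 ∈ 𝓝 (0 : ℂ) := ball_mem_nhds _ one_pos
  have hd1 : DifferentiableOn ℂ (deriv h) (ball 0 1) := hh.deriv isOpen_ball
  have hd2 : DifferentiableOn ℂ (deriv (deriv h)) (ball 0 1) := hd1.deriv isOpen_ball
  set Q : ℂ → ℂ := fun z => deriv (deriv h) z / deriv h z with hQ
  have hQd : DifferentiableOn ℂ Q (ball 0 1) := hd2.div hd1 hne
  have hβ : 0 < 1 - α := by linarith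
  have hQb : ∀ j, ‖taylorCoeff Q j‖ ≤ 2 * (1 - α) := by
    intro j
    -- This is `1 + z h''/h' - α`, which has positive real part and value `1 - α` at the origin.
    have hpd : DifferentiableOn ℂ (fun z => ((1 - α : ℝ) : ℂ) + z * Q z) (ball 0 1) :=
      (differentiableOn_const _).add (differentiableOn_id.mul hQd)
    have hb := norm_taylorCoeff_le_two_mul_re hpd (fun z hz => by
      have := hord z hz
      rw [mul_div_assoc, Complex.add_re, Complex.one_re] at this
      rw [Complex.add_re, Complex.ofReal_re]
      change 0 < 1 - α + (z * (deriv (deriv h) z / deriv h z)).re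
      linarith) (N := j + 1) (by omega)
    have he : taylorCoeff (fun z => ((1 - α : ℝ) : ℂ) + z * Q z) (j + 1) = taylorCoeff Q j := by
      rw [← taylorCoeff_id_mul_succ (hQd.analyticAt h0), taylorCoeff, taylorCoeff,
        iteratedDeriv_const_add (by omega)]
    rw [he] at hb
    simpa using hb
  have hrec : ∀ k : ℕ, ((k : ℂ) + 1) * taylorCoeff (deriv h) (k + 1) =
      ∑ i ∈ Finset.range (k + 1), taylorCoeff (deriv h) i * taylorCoeff Q (k - i) := by
    intro k
    rw [← taylorCoeff_deriv, ← taylorCoeff_mul (hd1.analyticAt h0) (hQd.analyticAt h0)]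
    refine taylorCoeff_congr ?_ k
    filter_upwards [h0] with z hz
    simp only [Pi.mul_apply, hQ]
    rw [mul_div_cancel₀ _ (hne z hz)]
  have hbound : ∀ k, ‖taylorCoeff (deriv h) k‖ ≤ (k + 1) * coeffBound (k + 1) α := by
    intro k
    induction k using Nat.strong_induction_on with
    | _ k ih =>
      rcases k with _ | k
      · simp [taylorCoeff, hd0, coeffBound_one]
      · have hk : (0 : ℝ) < (k : ℝ) + 1 := by positivity
        have h1 : ((k : ℝ) + 1) * ‖taylorCoeff (deriv h) (k + 1)‖ ≤
            (k + 1) * ((k + 2) * coeffBound (k + 2) α) := by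
          rw [← sum_mul_coeffBound, Finset.mul_sum]
          have h2 : ((k : ℝ) + 1) * ‖taylorCoeff (deriv h) (k + 1)‖ =
              ‖((k : ℂ) + 1) * taylorCoeff (deriv h) (k + 1)‖ := by
            rw [norm_mul]
            congr 1
            rw [← Nat.cast_succ (R := ℂ), Complex.norm_natCast, Nat.cast_succ]
          rw [h2, hrec]
          refine (norm_sum_le _ _).trans (Finset.sum_le_sum fun i hi => ?_)
          rw [norm_mul, mul_comm]
          exact mul_le_mul (hQb _) (ih i (Finset.mem_range.1 hi)) (norm_nonneg _) (by linarith)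
        have h3 := le_of_mul_le_mul_left h1 hk
        push_cast
        rwa [show (k : ℝ) + 1 + 1 = k + 2 by ring]
  have hk : (0 : ℝ) < (k : ℝ) + 1 := by positivity
  have h1 := hbound k
  rw [taylorCoeff_deriv, norm_mul, ← Nat.cast_succ (R := ℂ), Complex.norm_natCast,
    Nat.cast_succ] at h1
  exact le_of_mul_le_mul_left h1 hk

/-! ### The function `L` -/

/-- The integrand of `L`, a lower bound for the Jacobian factor `|h'| - |g'|`. -/
noncomputable def jacobianBound (α t : ℝ) : ℝ := (1 - t) * (1 + t) ^ (2 * α - 2)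

theorem L_zero (α : ℝ) : L 0 α = 0 := by
  unfold L
  split_ifs <;> simp

/-- All three branches are `∫₀^r (1 - t)(1 + t)^{2α-2} dt`; at `α = 0` and `α = 1/2` a power in the
antiderivative becomes a logarithm. -/
theorem hasDerivAt_L (α : ℝ) {r : ℝ} (hr : -1 < r) :
    HasDerivAt (fun r => L r α) (jacobianBound α r) r := by
  have h1 : (0 : ℝ) < 1 + r := by linarith
  have hlin : HasDerivAt (fun r : ℝ => 1 + r) 1 r := (hasDerivAt_id r).const_add 1
  unfold L jacobianBound
  by_cases h0 : α = 0
  · simp only [if_pos h0]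
    refine (((hasDerivAt_id r).const_mul 2).div hlin h1.ne' |>.sub (hlin.log h1.ne')).congr_deriv ?_
    rw [h0, show (2 * 0 - 2 : ℝ) = -((2 : ℕ) : ℝ) by norm_num, Real.rpow_neg h1.le,
      Real.rpow_natCast]
    simp only [id]
    field_simp
    ring
  by_cases h12 : α = 1 / 2
  · simp only [if_neg h0, if_pos h12]
    refine (((hlin.log h1.ne').const_mul 2).sub (hasDerivAt_id r)).congr_deriv ?_
    rw [h12, show (2 * (1 / 2) - 2 : ℝ) = -1 by norm_num, Real.rpow_neg_one]
    field_simp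
    ring
  · simp only [if_neg h0, if_neg h12]
    have h2 : 2 * α - 1 ≠ 0 := fun h => h12 (by linarith)
    have hp := hlin.rpow_const (p := 2 * α) (Or.inl h1.ne')
    have hq : HasDerivAt (fun r : ℝ => 1 + r + 2 * α - 2 * r * α) (1 - 2 * α) r := by
      refine (((hlin.add_const (2 * α)).sub
        (((hasDerivAt_id r).const_mul 2).mul_const α))).congr_deriv ?_
      ring
    refine (((hp.mul hq).sub (hlin.mul_const (1 + 2 * α))).div
      ((hlin.const_mul (2 * α)).mul_const (2 * α - 1)) (by positivity)).congr_deriv ?_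
    have e1 : (1 + r) ^ (2 * α) = (1 + r) ^ (2 * α - 2) * (1 + r) ^ 2 := by
      rw [← Real.rpow_natCast, ← Real.rpow_add h1]
      congr 1
      push_cast
      ring
    have e2 : (1 + r) ^ (2 * α - 1) = (1 + r) ^ (2 * α - 2) * (1 + r) := by
      rw [← Real.rpow_add_one h1.ne']
      congr 1
      ring
    simp only [Pi.sub_apply, Pi.mul_apply]
    rw [e1, e2]
    generalize (1 + r) ^ (2 * α - 2) = X
    field_simp
    ring

theorem continuousAt_L (α : ℝ) {r : ℝ} (hr : -1 < r) : ContinuousAt (fun r => L r α) r :=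
  (hasDerivAt_L α hr).continuousAt

theorem jacobianBound_pos (α : ℝ) {t : ℝ} (h0 : 0 ≤ t) (h1 : t < 1) : 0 < jacobianBound α t :=
  mul_pos (by linarith) (Real.rpow_pos_of_pos (by linarith) _)

theorem jacobianBound_anti {α : ℝ} (hα1 : α < 1) {s t : ℝ} (hs : 0 ≤ s) (hst : s ≤ t)
    (ht : t < 1) : jacobianBound α t ≤ jacobianBound α s :=
  mul_le_mul (by linarith) (Real.rpow_le_rpow_of_nonpos (by linarith) (by linarith) (by linarith))
    (Real.rpow_nonneg (by linarith) _) (by linarith)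

theorem exists_L_eq_mul_jacobianBound (α : ℝ) {r : ℝ} (h0 : 0 < r) :
    ∃ c ∈ Ioo 0 r, L r α = r * jacobianBound α c := by
  obtain ⟨c, hc, he⟩ := exists_hasDerivAt_eq_slope (fun r => L r α) (jacobianBound α) h0
    (fun t ht => (continuousAt_L α (by linarith [ht.1])).continuousWithinAt)
    (fun t ht => hasDerivAt_L α (by linarith [ht.1]))
  refine ⟨c, hc, ?_⟩
  rw [he, L_zero, sub_zero, sub_zero, mul_div_cancel₀ _ h0.ne']

theorem mul_jacobianBound_le_L {α : ℝ} (hα1 : α < 1) {r : ℝ} (h0 : 0 < r) (h1 : r < 1) :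
    r * jacobianBound α r ≤ L r α := by
  obtain ⟨c, hc, he⟩ := exists_L_eq_mul_jacobianBound α h0
  rw [he]
  exact mul_le_mul_of_nonneg_left (jacobianBound_anti hα1 hc.1.le hc.2.le h1) h0.le

theorem L_pos {α : ℝ} (hα1 : α < 1) {r : ℝ} (h0 : 0 < r) (h1 : r < 1) : 0 < L r α :=
  (mul_pos h0 (jacobianBound_pos α h0.le h1)).trans_le (mul_jacobianBound_le_L hα1 h0 h1)

theorem L_le_self {α : ℝ} (hα1 : α < 1) {r : ℝ} (h0 : 0 < r) (h1 : r < 1) : L r α ≤ r := by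
  obtain ⟨c, hc, he⟩ := exists_L_eq_mul_jacobianBound α h0
  have := jacobianBound_anti hα1 le_rfl hc.1.le (hc.2.trans h1)
  have h2 : jacobianBound α 0 = 1 := by simp [jacobianBound]
  rw [he]
  nlinarith

/-- `L(r) / r` is the mean over `[0, r]` of a decreasing function. -/
theorem L_div_anti {α : ℝ} (hα1 : α < 1) {a b : ℝ} (ha : 0 < a) (hab : a ≤ b) (hb : b < 1) :
    L b α / b ≤ L a α / a := by
  have hder : ∀ t ∈ Ioo (0 : ℝ) 1,
      HasDerivAt (fun t => L t α / t) ((jacobianBound α t * t - L t α * 1) / t ^ 2) t :=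
    fun t ht => (hasDerivAt_L α (by linarith [ht.1])).div (hasDerivAt_id t) ht.1.ne'
  have hanti : AntitoneOn (fun t => L t α / t) (Ioo 0 1) := by
    refine antitoneOn_of_deriv_nonpos (convex_Ioo 0 1)
      (fun t ht => (hder t ht).continuousAt.continuousWithinAt)
      (fun t ht => (hder t (interior_subset ht)).differentiableAt.differentiableWithinAt) ?_
    intro t ht
    have ht := interior_subset ht
    rw [(hder t ht).deriv]
    refine div_nonpos_of_nonpos_of_nonneg ?_ (sq_nonneg t)
    have := mul_jacobianBound_le_L hα1 ht.1 ht.2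
    linarith
  exact hanti ⟨ha, by linarith⟩ ⟨by linarith, hb⟩ hab

/-- The comparison function for `L` has the larger derivative. -/
theorem one_sub_mul_rpow_le {α t : ℝ} (hα0 : 0 ≤ α) (hα1 : α < 1) (h0 : 0 ≤ t) (h1 : t < 1) :
    (1 - t) * (1 + t) ^ (α + 1 / 2) ≤ 1 + (α - 1 / 2) * t := by
  -- Bernoulli's inequality needs an exponent in `[0, 1]`: `α + 1/2` for small `α`, `α - 1/2` for
  -- large `α`.
  rcases le_total α (1 / 2) with h | h
  · have := rpow_one_add_le_one_add_mul_self (s := t) (by linarith) (p := α + 1 / 2)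
      (by linarith) (by linarith)
    calc (1 - t) * (1 + t) ^ (α + 1 / 2) ≤ (1 - t) * (1 + (α + 1 / 2) * t) :=
          mul_le_mul_of_nonneg_left this (by linarith)
      _ ≤ _ := by nlinarith [mul_nonneg h0 h0]
  · have := rpow_one_add_le_one_add_mul_self (s := t) (by linarith) (p := α - 1 / 2)
      (by linarith) (by linarith)
    have he : (1 + t) ^ (α + 1 / 2) = (1 + t) ^ (α - 1 / 2) * (1 + t) := by
      rw [← Real.rpow_add_one (by linarith)]
      congr 1
      ring
    have h2 : 0 ≤ 1 + (α - 1 / 2) * t := by nlinarith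
    calc (1 - t) * (1 + t) ^ (α + 1 / 2) = (1 - t ^ 2) * (1 + t) ^ (α - 1 / 2) := by
          rw [he]; ring
      _ ≤ (1 - t ^ 2) * (1 + (α - 1 / 2) * t) :=
          mul_le_mul_of_nonneg_left this (by nlinarith)
      _ ≤ _ := by nlinarith [mul_nonneg h2 (sq_nonneg t)]

/-- The exponent is the one for which squaring `L / r` and multiplying by `1 - r²` gives exactly `(1
- r)(1 + r)^{2α-2}`. Both sides vanish at `0`, so it suffices to compare derivatives. -/
theorem L_le_mul_rpow {α r : ℝ} (hα0 : 0 ≤ α) (hα1 : α < 1) (h0 : 0 ≤ r) (h1 : r < 1) :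
    L r α ≤ r * (1 + r) ^ (α - 3 / 2) := by
  set F : ℝ → ℝ := fun t => t * (1 + t) ^ (α - 3 / 2) - L t α with hF
  have hder : ∀ t ∈ Ico (0 : ℝ) 1, HasDerivAt F
      (1 * (1 + t) ^ (α - 3 / 2) + t * (1 * (α - 3 / 2) * (1 + t) ^ (α - 3 / 2 - 1)) -
        jacobianBound α t) t := by
    intro t ht
    have hlin : HasDerivAt (fun r : ℝ => 1 + r) 1 t := (hasDerivAt_id t).const_add 1
    exact ((hasDerivAt_id t).mul (hlin.rpow_const (Or.inl (by linarith [ht.1])))).sub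
      (hasDerivAt_L α (by linarith [ht.1]))
  have hmono : MonotoneOn F (Ico 0 1) := by
    refine monotoneOn_of_deriv_nonneg (convex_Ico 0 1)
      (fun t ht => (hder t ht).continuousAt.continuousWithinAt)
      (fun t ht => (hder t (interior_subset ht)).differentiableAt.differentiableWithinAt) ?_
    intro t ht
    have ht := interior_subset ht
    have hp : (0 : ℝ) < 1 + t := by linarith [ht.1]
    have e1 : (1 + t) ^ (α - 3 / 2) = (1 + t) ^ (α - 3 / 2 - 1) * (1 + t) := by
      rw [← Real.rpow_add_one hp.ne']
      congr 1
      ring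
    have e2 : (1 + t) ^ (2 * α - 2) = (1 + t) ^ (α - 3 / 2 - 1) * (1 + t) ^ (α + 1 / 2) := by
      rw [← Real.rpow_add hp]
      congr 1
      ring
    rw [(hder t ht).deriv, jacobianBound, e2, e1]
    have h2 := one_sub_mul_rpow_le hα0 hα1 ht.1 ht.2
    have h3 : 0 < (1 + t) ^ (α - 3 / 2 - 1) := Real.rpow_pos_of_pos hp _
    nlinarith [mul_nonneg h3.le (sub_nonneg.2 h2)]
  have := hmono (left_mem_Ico.2 one_pos) ⟨h0, h1⟩ h0
  simp only [hF, L_zero, zero_mul, sub_zero] at this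
  linarith

/-! ### The function `A` -/

theorem A_eq (r α : ℝ) : A r α = (1 - r ^ 2) * (L r α / r) ^ 2 := by
  rw [A, div_pow]
  ring

theorem A_le_jacobianBound {α r : ℝ} (hα0 : 0 ≤ α) (hα1 : α < 1) (h0 : 0 < r) (h1 : r < 1) :
    A r α ≤ jacobianBound α r := by
  have hp : (0 : ℝ) < 1 + r := by linarith
  have h2 : L r α / r ≤ (1 + r) ^ (α - 3 / 2) := by
    rw [div_le_iff₀ h0, mul_comm]
    exact L_le_mul_rpow hα0 hα1 h0.le h1
  have h3 : 0 ≤ L r α / r := (div_pos (L_pos hα1 h0 h1) h0).le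
  have h4 : ((1 + r) ^ (α - 3 / 2)) ^ 2 * (1 + r) = (1 + r) ^ (2 * α - 2) := by
    rw [← Real.rpow_natCast, ← Real.rpow_mul hp.le, ← Real.rpow_add_one hp.ne']
    congr 1
    push_cast
    ring
  rw [A_eq, jacobianBound, ← h4]
  calc (1 - r ^ 2) * (L r α / r) ^ 2 ≤ (1 - r ^ 2) * ((1 + r) ^ (α - 3 / 2)) ^ 2 :=
        mul_le_mul_of_nonneg_left (pow_le_pow_left₀ h3 h2 2) (by nlinarith)
    _ = _ := by ring

theorem A_strictAnti {α a b : ℝ} (hα1 : α < 1) (ha : 0 < a) (hab : a < b) (hb : b < 1) :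
    A b α < A a α := by
  have h1 := L_div_anti hα1 ha hab.le hb
  have h2 : 0 < L b α / b := div_pos (L_pos hα1 (ha.trans hab) hb) (ha.trans hab)
  rw [A_eq, A_eq]
  exact mul_lt_mul (by nlinarith) (pow_le_pow_left₀ h2.le h1 2) (by positivity) (by nlinarith)

theorem continuousAt_A (α : ℝ) {r : ℝ} (h0 : 0 < r) : ContinuousAt (fun r => A r α) r := by
  unfold A
  exact ((continuousAt_const.sub (continuousAt_id.pow 2)).div (continuousAt_id.pow 2)
    (by simpa using h0.ne')).mul ((continuousAt_L α (by linarith)).pow 2)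

/-- The lower bound is continuous at `0` with value `1`, whereas the formula for `A` has `r²` in the
denominator; it serves to show `psi > 0` near `0`. -/
theorem le_A {α r : ℝ} (hα1 : α < 1) (h0 : 0 < r) (h1 : r < 1) :
    (1 - r ^ 2) * jacobianBound α r ^ 2 ≤ A r α := by
  rw [A_eq]
  refine mul_le_mul_of_nonneg_left (pow_le_pow_left₀ (jacobianBound_pos α h0.le h1).le ?_ 2)
    (by nlinarith)
  rw [le_div_iff₀ h0, mul_comm]
  exact mul_jacobianBound_le_L hα1 h0 h1

theorem A_le {α r : ℝ} (hα1 : α < 1) (h0 : 0 < r) (h1 : r < 1) : A r α ≤ 1 - r ^ 2 := by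
  have h2 : L r α / r ≤ 1 := (div_le_one h0).2 (L_le_self hα1 h0 h1)
  have h3 : 0 ≤ L r α / r := (div_pos (L_pos hα1 h0 h1) h0).le
  rw [A_eq]
  exact mul_le_of_le_one_right (by nlinarith) (pow_le_one₀ h3 h2)

/-! ### Tails of power series with coefficients of linear growth -/

theorem summable_linear_geometric (n : ℕ) {r : ℝ} (h : |r| < 1) :
    Summable fun j : ℕ => ((n + 1 + j : ℕ) : ℝ) * |r| ^ (n + j) := by
  have h1 := (summable_pow_mul_geometric_of_norm_lt_one (R := ℝ) 1 (r := |r|) (by simpa using h))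
  have h2 := (h1.add (summable_geometric_of_norm_lt_one (x := |r|) (by simpa using h)))
  refine ((summable_nat_add_iff n).2 h2).congr fun j => ?_
  push_cast
  rw [add_comm j n]
  ring

section Tail

variable {c : ℕ → ℝ}

theorem summable_tail (hc0 : ∀ k, 0 ≤ c k) (hc1 : ∀ k, c k ≤ k) (n : ℕ) {r : ℝ} (h : |r| < 1) :
    Summable fun j : ℕ => c (n + 1 + j) * r ^ (n + j) := by
  refine Summable.of_norm_bounded (summable_linear_geometric n h) fun j => ?_
  rw [norm_mul, norm_pow, Real.norm_eq_abs, Real.norm_eq_abs, abs_of_nonneg (hc0 _)]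
  exact mul_le_mul_of_nonneg_right (hc1 _) (by positivity)

theorem continuousAt_tail (hc0 : ∀ k, 0 ≤ c k) (hc1 : ∀ k, c k ≤ k) (n : ℕ) {r : ℝ}
    (h : |r| < 1) : ContinuousAt (fun r => ∑' j : ℕ, c (n + 1 + j) * r ^ (n + j)) r := by
  obtain ⟨R, hrR, hR⟩ := exists_between h
  have hR0 : 0 < R := (abs_nonneg r).trans_lt hrR
  have hcont : ContinuousOn (fun r => ∑' j : ℕ, c (n + 1 + j) * r ^ (n + j)) (Icc (-R) R) := by
    refine continuousOn_tsum (fun j => by fun_prop)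
      (summable_linear_geometric n (r := R) (by rwa [abs_of_pos hR0])) fun j x hx => ?_
    rw [norm_mul, norm_pow, Real.norm_eq_abs, Real.norm_eq_abs, abs_of_nonneg (hc0 _),
      abs_of_pos hR0]
    exact mul_le_mul (hc1 _) (pow_le_pow_left₀ (abs_nonneg _) (abs_le.2 hx) _) (by positivity)
      (by positivity)
  exact hcont.continuousAt (Icc_mem_nhds (abs_lt.1 hrR).1 (abs_lt.1 hrR).2)

theorem tail_mono (hc0 : ∀ k, 0 ≤ c k) (hc1 : ∀ k, c k ≤ k) (n : ℕ) {a b : ℝ} (ha : 0 ≤ a)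
    (hab : a ≤ b) (hb : b < 1) :
    ∑' j : ℕ, c (n + 1 + j) * a ^ (n + j) ≤ ∑' j : ℕ, c (n + 1 + j) * b ^ (n + j) :=
  (summable_tail hc0 hc1 n (by rw [abs_of_nonneg ha]; linarith)).tsum_le_tsum
    (fun j => mul_le_mul_of_nonneg_left (pow_le_pow_left₀ ha hab _) (hc0 _))
    (summable_tail hc0 hc1 n (by rw [abs_of_nonneg (ha.trans hab)]; exact hb))

theorem tail_zero {n : ℕ} (hn : 1 ≤ n) : ∑' j : ℕ, c (n + 1 + j) * (0 : ℝ) ^ (n + j) = 0 := by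
  have : ∀ j : ℕ, c (n + 1 + j) * (0 : ℝ) ^ (n + j) = 0 := fun j => by
    rw [zero_pow (by omega), mul_zero]
  simp [this]

theorem le_tail (hc0 : ∀ k, 0 ≤ c k) (hc1 : ∀ k, c k ≤ k) (n : ℕ) {r : ℝ} (h0 : 0 ≤ r)
    (h1 : r < 1) : c (n + 1) * r ^ n ≤ ∑' j : ℕ, c (n + 1 + j) * r ^ (n + j) := by
  have := (summable_tail hc0 hc1 n (by rwa [abs_of_nonneg h0])).le_tsum 0
    fun j _ => mul_nonneg (hc0 _) (by positivity)
  simpa using this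

end Tail

theorem coeffBound_le_one {α : ℝ} (hα0 : 0 ≤ α) (hα1 : α < 1) (k : ℕ) : coeffBound k α ≤ 1 := by
  rcases k with _ | k
  · simp [coeffBound]
  · induction k with
    | zero => exact (coeffBound_one α).le
    | succ k ih =>
      have h1 := succ_mul_coeffBound_succ (k := k + 1) (by omega) α
      have h2 := coeffBound_nonneg hα1 (k + 1)
      push_cast at h1
      have h3 : (0 : ℝ) < (k : ℝ) + 1 + 1 := by positivity
      refine le_of_mul_le_mul_left ?_ h3
      rw [h1]
      nlinarith

/-- The coefficients of the majorant of `h'`. -/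
noncomputable def analyticCoeff (α : ℝ) (k : ℕ) : ℝ := k * coeffBound k α

/-- The coefficients of the majorant of `g'`. -/
noncomputable def coanalyticCoeff (α : ℝ) (k : ℕ) : ℝ := analyticCoeff α (k - 1)

theorem analyticCoeff_nonneg {α : ℝ} (hα1 : α < 1) (k : ℕ) : 0 ≤ analyticCoeff α k :=
  mul_nonneg (by positivity) (coeffBound_nonneg hα1 k)

theorem analyticCoeff_le {α : ℝ} (hα0 : 0 ≤ α) (hα1 : α < 1) (k : ℕ) : analyticCoeff α k ≤ k :=
  mul_le_of_le_one_right (by positivity) (coeffBound_le_one hα0 hα1 k)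

theorem coanalyticCoeff_nonneg {α : ℝ} (hα1 : α < 1) (k : ℕ) : 0 ≤ coanalyticCoeff α k :=
  analyticCoeff_nonneg hα1 _

theorem coanalyticCoeff_le {α : ℝ} (hα0 : 0 ≤ α) (hα1 : α < 1) (k : ℕ) :
    coanalyticCoeff α k ≤ k :=
  (analyticCoeff_le hα0 hα1 _).trans (by exact_mod_cast Nat.sub_le k 1)

theorem analyticTerm_eq (α r : ℝ) (n j : ℕ) :
    analyticTerm α r (n + 1 + j) = analyticCoeff α (n + 1 + j) * r ^ (n + j) := by
  rw [analyticTerm, analyticCoeff, show n + 1 + j - 1 = n + j by omega]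

/-- `k A_k = (k - 2α) A_{k-1}` cancels the denominator and leaves `(k - 1) A_{k-1}`. Since `m ≥ 1`,
only `k ≥ 2` occurs, where `k - 2α ≠ 0`. -/
theorem coanalyticTerm_eq {α : ℝ} (hα1 : α < 1) (r : ℝ) {m : ℕ} (hm : 1 ≤ m) (j : ℕ) :
    coanalyticTerm α r (m + 1 + j) = coanalyticCoeff α (m + 1 + j) * r ^ (m + j) := by
  rw [coanalyticTerm, coanalyticCoeff, analyticCoeff, show m + 1 + j - 1 = m + j by omega,
    show m + 1 + j = m + j + 1 by omega]
  have h1 := succ_mul_coeffBound_succ (k := m + j) (by omega) α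
  have h2 : (1 : ℝ) ≤ ((m + j : ℕ) : ℝ) := by exact_mod_cast (by omega : 1 ≤ m + j)
  have h3 : (((m + j : ℕ) : ℝ) + 1 - 2 * α) ≠ 0 := by linarith
  rw [Nat.cast_succ]
  congr 1
  field_simp
  linear_combination ((m + j : ℕ) : ℝ) * h1

/-! ### The function `psi` -/

theorem psi_eq {α : ℝ} (hα1 : α < 1) (n : ℕ) {m : ℕ} (hm : 1 ≤ m) (r : ℝ) :
    psi n m r α = A r α - ∑' j : ℕ, analyticCoeff α (n + 1 + j) * r ^ (n + j) -
      ∑' j : ℕ, coanalyticCoeff α (m + 1 + j) * r ^ (m + j) := by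
  simp only [psi, analyticTerm_eq, coanalyticTerm_eq hα1 r hm]

theorem psi_strictAntiOn {α : ℝ} (hα0 : 0 ≤ α) (hα1 : α < 1) (n : ℕ) {m : ℕ} (hm : 1 ≤ m) :
    StrictAntiOn (fun r => psi n m r α) (Ioo 0 1) := by
  intro a ha b hb hab
  simp only [psi_eq hα1 n hm]
  have h1 := A_strictAnti hα1 ha.1 hab hb.2
  have h2 := tail_mono (analyticCoeff_nonneg hα1) (analyticCoeff_le hα0 hα1) n ha.1.le hab.le hb.2
  have h3 := tail_mono (coanalyticCoeff_nonneg hα1) (coanalyticCoeff_le hα0 hα1) m ha.1.le hab.le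
    hb.2
  linarith

theorem continuousAt_psi {α : ℝ} (hα0 : 0 ≤ α) (hα1 : α < 1) (n : ℕ) {m : ℕ} (hm : 1 ≤ m) {r : ℝ}
    (hr : r ∈ Ioo (0 : ℝ) 1) : ContinuousAt (fun r => psi n m r α) r := by
  have h : |r| < 1 := by rw [abs_of_pos hr.1]; exact hr.2
  simp only [psi_eq hα1 n hm]
  exact ((continuousAt_A α hr.1).sub
    (continuousAt_tail (analyticCoeff_nonneg hα1) (analyticCoeff_le hα0 hα1) n h)).sub
    (continuousAt_tail (coanalyticCoeff_nonneg hα1) (coanalyticCoeff_le hα0 hα1) m h)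

theorem exists_psi_pos {α : ℝ} (hα0 : 0 ≤ α) (hα1 : α < 1) {n m : ℕ} (hn : 1 ≤ n) (hm : 1 ≤ m) :
    ∃ a ∈ Ioo (0 : ℝ) (1 / 2), 0 < psi n m a α := by
  have h00 : |(0 : ℝ)| < 1 := by simp
  have hJ : ContinuousAt (jacobianBound α) 0 := by
    unfold jacobianBound
    exact (continuousAt_const.sub continuousAt_id).mul
      ((continuousAt_const.add continuousAt_id).rpow_const (Or.inl (by simp)))
  have hcont : ContinuousAt (fun r => (1 - r ^ 2) * jacobianBound α r ^ 2 -
      ∑' j : ℕ, analyticCoeff α (n + 1 + j) * r ^ (n + j) -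
      ∑' j : ℕ, coanalyticCoeff α (m + 1 + j) * r ^ (m + j)) 0 :=
    ((((continuousAt_const.sub (continuousAt_id.pow 2)).mul (hJ.pow 2)).sub
      (continuousAt_tail (analyticCoeff_nonneg hα1) (analyticCoeff_le hα0 hα1) n h00)).sub
      (continuousAt_tail (coanalyticCoeff_nonneg hα1) (coanalyticCoeff_le hα0 hα1) m h00))
  have hev := hcont.eventually (lt_mem_nhds (a := 0) (by
    simp only [tail_zero hn, tail_zero hm]
    norm_num [jacobianBound]))
  have hev2 := (hev.filter_mono (nhdsWithin_le_nhds (s := Ioi 0))).and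
    (Ioo_mem_nhdsGT (show (0 : ℝ) < 1 / 2 by norm_num))
  obtain ⟨a, ha, hab⟩ := hev2.exists
  refine ⟨a, hab, ?_⟩
  rw [psi_eq hα1 n hm]
  have := le_A hα1 hab.1 (hab.2.trans (by norm_num))
  linarith

/-- As `r → 1`, `A ≤ 1 - r²` tends to `0`, while the first term of the analytic tail alone tends to
`(n + 1) A_{n+1} > 0`. -/
theorem exists_psi_neg {α : ℝ} (hα0 : 0 ≤ α) (hα1 : α < 1) (n : ℕ) {m : ℕ} (hm : 1 ≤ m) :
    ∃ b ∈ Ioo (1 / 2 : ℝ) 1, psi n m b α < 0 := by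
  have hcont : Continuous (fun r : ℝ => 1 - r ^ 2 - analyticCoeff α (n + 1) * r ^ n) := by
    fun_prop
  have hpos : 0 < analyticCoeff α (n + 1) :=
    mul_pos (by positivity) (coeffBound_pos hα1 _)
  have hev := (hcont.continuousAt (x := 1)).eventually_lt
    (continuousAt_const (y := (0 : ℝ))) (by simpa using hpos)
  have hev2 := (hev.filter_mono (nhdsWithin_le_nhds (s := Iio 1))).and
    (Ioo_mem_nhdsLT (show (1 / 2 : ℝ) < 1 by norm_num))
  obtain ⟨b, hb, hbb⟩ := hev2.exists
  refine ⟨b, hbb, ?_⟩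
  rw [psi_eq hα1 n hm]
  have hb0 : 0 < b := by linarith [hbb.1]
  have h1 := A_le hα1 hb0 hbb.2
  have h2 := le_tail (analyticCoeff_nonneg hα1) (analyticCoeff_le hα0 hα1) n hb0.le hbb.2
  have h3 : 0 ≤ ∑' j : ℕ, coanalyticCoeff α (m + 1 + j) * b ^ (m + j) :=
    tsum_nonneg fun j => mul_nonneg (coanalyticCoeff_nonneg hα1 _) (by positivity)
  linarith

theorem exists_psi_eq_zero {α : ℝ} (hα0 : 0 ≤ α) (hα1 : α < 1) {n m : ℕ} (hn : 1 ≤ n)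
    (hm : 1 ≤ m) : ∃ ρ ∈ Ioo (0 : ℝ) 1, psi n m ρ α = 0 := by
  obtain ⟨a, ha, hpa⟩ := exists_psi_pos hα0 hα1 hn hm
  obtain ⟨b, hb, hpb⟩ := exists_psi_neg hα0 hα1 n hm
  have hab : a ≤ b := by linarith [ha.2, hb.1]
  obtain ⟨ρ, hρ, he⟩ := intermediate_value_Icc' (f := fun r => psi n m r α) hab
    (fun r hr => (continuousAt_psi hα0 hα1 n hm
      ⟨by linarith [ha.1, hr.1], by linarith [hb.2, hr.2]⟩).continuousWithinAt)
    (show (0 : ℝ) ∈ Icc (psi n m b α) (psi n m a α) from ⟨hpb.le, hpa.le⟩)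
  exact ⟨ρ, ⟨by linarith [ha.1, hρ.1], by linarith [hb.2, hρ.2]⟩, he⟩

/-! ### The case `α = 1 / 2` -/

theorem analyticCoeff_half (k : ℕ) : analyticCoeff (1 / 2) (k + 1) = 1 := by
  induction k with
  | zero => simp [analyticCoeff, coeffBound_one]
  | succ k ih =>
    have := succ_mul_coeffBound_succ (k := k + 1) (by omega) (1 / 2)
    rw [analyticCoeff] at *
    push_cast at *
    linarith

theorem psi_half (n : ℕ) {m : ℕ} (hm : 1 ≤ m) {r : ℝ} (h0 : 0 ≤ r) (h1 : r < 1) :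
    psi n m r (1 / 2) = A r (1 / 2) - r ^ n / (1 - r) - r ^ m / (1 - r) := by
  have hg : ∀ k : ℕ, ∑' j : ℕ, r ^ (k + j) = r ^ k / (1 - r) := fun k => by
    simpa only [pow_add, div_eq_mul_inv] using
      ((hasSum_geometric_of_lt_one h0 h1).mul_left (r ^ k)).tsum_eq
  have e1 : ∀ j, analyticCoeff (1 / 2) (n + 1 + j) = 1 := fun j => by
    rw [show n + 1 + j = n + j + 1 by omega, analyticCoeff_half]
  have e2 : ∀ j, coanalyticCoeff (1 / 2) (m + 1 + j) = 1 := fun j => by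
    rw [coanalyticCoeff, show m + 1 + j - 1 = m + j - 1 + 1 by omega, analyticCoeff_half]
  rw [psi_eq (by norm_num) n hm, ← hg, ← hg]
  simp only [e1, e2, one_mul]

/-- Obtained from `log (1 + r) ≥ 2r / (2 + r)`, which makes the bound for `A` rational in `r`. -/
theorem le_L_half {r : ℝ} (h0 : 0 < r) :
    (2 - r) / (2 + r) ≤ L r (1 / 2) / r := by
  have hL : L r (1 / 2) = 2 * Real.log (1 + r) - r := by
    norm_num [L]
  have hlog : 2 * r / (2 + r) ≤ Real.log (1 + r) := by
    have := Real.le_log_one_add_of_nonneg h0.le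
    rwa [add_comm r 2] at this
  rw [hL, le_div_iff₀ h0]
  have : (2 - r) / (2 + r) * r = 2 * (2 * r / (2 + r)) - r := by
    field_simp
    ring
  linarith

/-- This is what `psi ≥ 0` at `r = 1 - 2 log l / l` reduces to once `r^l ≤ l⁻²` and `1 - r = 2 log l
/ l` are inserted. -/
theorem one_le_two_mul_sq_log_mul {l : ℕ} (hl : 3 ≤ l)
    (hr0 : 0 < 1 - 2 * Real.log l / l) :
    1 ≤ 2 * Real.log l ^ 2 * ((1 + (1 - 2 * Real.log l / l)) *
      ((2 - (1 - 2 * Real.log l / l)) / (2 + (1 - 2 * Real.log l / l))) ^ 2) := by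
  have hlp : (0 : ℝ) < l := by positivity
  have hlr : (3 : ℝ) ≤ l := by exact_mod_cast hl
  have hlog1 : 1 ≤ Real.log l := by
    rw [Real.le_log_iff_exp_le hlp]
    linarith [Real.exp_one_lt_d9]
  set x := Real.log l with hx
  set r := 1 - 2 * x / l with hr
  have hr1 : r ≤ 1 := by
    have : 0 ≤ 2 * x / l := by positivity
    linarith
  have hd : 0 < 2 + r := by linarith
  -- For `l ≥ 5`, `e³ < 25` gives `log l ≥ 3/2`, and the rational factor is at least `2/9`, its
  -- value at `r = 1`; then `2 · (9/4) · (2/9) = 1`. For `l = 3, 4` only `log l ≥ 1` is used, but `r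
  -- ≤ 1/2` raises the factor to at least `1/2`.
  rcases le_or_gt 5 l with h5 | h5
  · have h5' : (5 : ℝ) ≤ l := by exact_mod_cast h5
    have hx2 : 3 / 2 ≤ x := by
      have h25 : (3 : ℝ) ≤ Real.log ((l : ℝ) ^ 2) := by
        rw [Real.le_log_iff_exp_le (by positivity), show (3 : ℝ) = ((3 : ℕ) : ℝ) * 1 by norm_num,
          Real.exp_nat_mul]
        calc Real.exp 1 ^ 3 ≤ (2.72 : ℝ) ^ 3 :=
              pow_le_pow_left₀ (Real.exp_pos 1).le (by linarith [Real.exp_one_lt_d9]) 3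
          _ ≤ 5 ^ 2 := by norm_num
          _ ≤ (l : ℝ) ^ 2 := pow_le_pow_left₀ (by norm_num) h5' 2
      rw [Real.log_pow] at h25
      push_cast at h25
      linarith
    have hC : 2 / 9 ≤ (1 + r) * ((2 - r) / (2 + r)) ^ 2 := by
      rw [div_pow, mul_div_assoc', div_le_div_iff₀ (by norm_num) (by positivity)]
      nlinarith [mul_nonneg hr0.le (sub_nonneg.2 hr1), mul_nonneg (mul_nonneg hr0.le
        (sub_nonneg.2 hr1)) (sub_nonneg.2 hr1)]
    nlinarith
  · have h4 : (l : ℝ) ≤ 4 := by exact_mod_cast (by omega : l ≤ 4)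
    have hr2 : r ≤ 1 / 2 := by
      have : 1 / 2 ≤ 2 * x / l := by
        rw [div_le_div_iff₀ (by norm_num) hlp]
        linarith
      linarith
    have hC : 1 / 2 ≤ (1 + r) * ((2 - r) / (2 + r)) ^ 2 := by
      rw [div_pow, mul_div_assoc', div_le_div_iff₀ (by norm_num) (by positivity)]
      nlinarith [mul_nonneg hr0.le (sub_nonneg.2 hr2), mul_nonneg (mul_nonneg hr0.le
        (sub_nonneg.2 hr2)) hr0.le]
    nlinarith

theorem psi_half_nonneg {n m l : ℕ} (hl : 3 ≤ l) (hln : l ≤ n) (hlm : l ≤ m)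
    (hr0 : 0 < 1 - 2 * Real.log l / l) : 0 ≤ psi n m (1 - 2 * Real.log l / l) (1 / 2) := by
  have hkey := one_le_two_mul_sq_log_mul hl hr0
  have hlp : (0 : ℝ) < l := by positivity
  have hx : 0 < Real.log l := Real.log_pos (by exact_mod_cast (by omega : 1 < l))
  have hs : 0 < 2 * Real.log l / l := by positivity
  set r := 1 - 2 * Real.log l / l with hr
  have h1r : 1 - r = 2 * Real.log l / l := by rw [hr]; ring
  have hr1 : r < 1 := by linarith
  have hpow : r ^ l ≤ 1 / (l : ℝ) ^ 2 := by
    have h1 : r ≤ Real.exp (-(2 * Real.log l / l)) := by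
      have := Real.add_one_le_exp (-(2 * Real.log l / l))
      linarith
    calc r ^ l ≤ Real.exp (-(2 * Real.log l / l)) ^ l := pow_le_pow_left₀ hr0.le h1 l
      _ = Real.exp (-(2 * Real.log l)) := by
          rw [← Real.exp_nat_mul]
          congr 1
          field_simp
      _ = 1 / (l : ℝ) ^ 2 := by
          rw [Real.exp_neg, show 2 * Real.log l = ((2 : ℕ) : ℝ) * Real.log l by norm_num,
            Real.exp_nat_mul, Real.exp_log hlp, one_div]
  have hn' : r ^ n ≤ 1 / (l : ℝ) ^ 2 := (pow_le_pow_of_le_one hr0.le hr1.le hln).trans hpow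
  have hm' : r ^ m ≤ 1 / (l : ℝ) ^ 2 := (pow_le_pow_of_le_one hr0.le hr1.le hlm).trans hpow
  have hq : (0 : ℝ) < (2 - r) / (2 + r) := div_pos (by linarith) (by linarith)
  have hA : (1 - r) * ((1 + r) * ((2 - r) / (2 + r)) ^ 2) ≤ A r (1 / 2) := by
    rw [A_eq, ← mul_assoc, show (1 - r) * (1 + r) = 1 - r ^ 2 by ring]
    exact mul_le_mul_of_nonneg_left (pow_le_pow_left₀ hq.le (le_L_half hr0) 2) (by nlinarith)
  rw [psi_half n (by omega) hr0.le hr1, sub_sub, ← add_div, sub_nonneg]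
  refine le_trans ?_ hA
  rw [div_le_iff₀ (by linarith)]
  calc r ^ n + r ^ m ≤ 2 / (l : ℝ) ^ 2 := by
        rw [show (2 : ℝ) / (l : ℝ) ^ 2 = 1 / (l : ℝ) ^ 2 + 1 / (l : ℝ) ^ 2 by ring]
        exact add_le_add hn' hm'
    _ ≤ 2 / (l : ℝ) ^ 2 * (2 * Real.log l ^ 2 * ((1 + r) * ((2 - r) / (2 + r)) ^ 2)) :=
        le_mul_of_one_le_right (by positivity) hkey
    _ = _ := by
        rw [h1r]
        field_simp

/-! ### Increments of Taylor remainders -/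

theorem norm_pow_succ_sub_le {z ζ : ℂ} {r : ℝ} (hz : ‖z‖ ≤ r) (hζ : ‖ζ‖ ≤ r) (k : ℕ) :
    ‖z ^ (k + 1) - ζ ^ (k + 1)‖ ≤ (k + 1) * r ^ k * ‖z - ζ‖ := by
  have hr : 0 ≤ r := (norm_nonneg z).trans hz
  rw [← geom_sum₂_mul, norm_mul]
  refine mul_le_mul_of_nonneg_right ?_ (norm_nonneg _)
  refine (norm_sum_le _ _).trans ?_
  have : ∀ i ∈ Finset.range (k + 1), ‖z ^ i * ζ ^ (k + 1 - 1 - i)‖ ≤ r ^ k := by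
    intro i hi
    have hi := Nat.lt_succ_iff.1 (Finset.mem_range.1 hi)
    rw [norm_mul, norm_pow, norm_pow, Nat.add_sub_cancel]
    calc ‖z‖ ^ i * ‖ζ‖ ^ (k - i) ≤ r ^ i * r ^ (k - i) := by gcongr
      _ = r ^ k := by rw [← pow_add, Nat.add_sub_cancel' hi]
  refine (Finset.sum_le_card_nsmul _ _ _ this).trans_eq ?_
  simp

theorem hasSum_sub_partialSum {φ : ℂ → ℂ} (hφ : DifferentiableOn ℂ φ (ball 0 1)) (h0 : φ 0 = 0)
    (n : ℕ) {z : ℂ} (hz : z ∈ ball (0 : ℂ) 1) :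
    HasSum (fun j : ℕ => taylorCoeff φ (n + 1 + j) * z ^ (n + 1 + j)) (φ z - partialSum n φ z) := by
  have h1 : HasSum (fun k : ℕ => taylorCoeff φ k * z ^ k) (φ z) := by
    refine (Complex.hasSum_taylorSeries_on_ball hφ hz).congr_fun fun k => ?_
    rw [taylorCoeff, sub_zero, smul_eq_mul, smul_eq_mul, div_eq_mul_inv]
    ring
  have h2 := (hasSum_nat_add_iff' (n + 1)).2 h1
  -- The partial sum starts at `k = 1`; the missing constant term is `φ 0 = 0`.
  have h3 : ∑ k ∈ Finset.range (n + 1), taylorCoeff φ k * z ^ k = partialSum n φ z := by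
    rw [partialSum, Finset.sum_range_eq_add_Ico _ (by omega), ← Finset.Ico_add_one_right_eq_Icc]
    simp [taylorCoeff, h0]
  rw [h3] at h2
  simpa only [add_comm] using h2

/-- Increments of the remainder of the Taylor series. -/
theorem norm_remainder_sub_le {φ : ℂ → ℂ} (hφ : DifferentiableOn ℂ φ (ball 0 1)) (h0 : φ 0 = 0)
    {c : ℕ → ℝ} (hc0 : ∀ k, 0 ≤ c k) (hc1 : ∀ k, c k ≤ k) {n : ℕ}
    (hc : ∀ k, n + 1 ≤ k → k * ‖taylorCoeff φ k‖ ≤ c k) {r : ℝ} (hr : r < 1) {z ζ : ℂ}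
    (hz : ‖z‖ ≤ r) (hζ : ‖ζ‖ ≤ r) :
    ‖(φ z - partialSum n φ z) - (φ ζ - partialSum n φ ζ)‖ ≤
      (∑' j : ℕ, c (n + 1 + j) * r ^ (n + j)) * ‖z - ζ‖ := by
  have hr0 : 0 ≤ r := (norm_nonneg z).trans hz
  have h1 := (hasSum_sub_partialSum hφ h0 n
    (mem_ball_zero_iff.2 (hz.trans_lt hr))).sub (hasSum_sub_partialSum hφ h0 n
    (mem_ball_zero_iff.2 (hζ.trans_lt hr)))
  have h2 := ((summable_tail hc0 hc1 n (r := r) (by rwa [abs_of_nonneg hr0])).hasSum).mul_right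
    ‖z - ζ‖
  rw [← h1.tsum_eq]
  refine tsum_of_norm_bounded h2 fun j => ?_
  rw [← mul_sub, norm_mul, show n + 1 + j = n + j + 1 by omega]
  have h3 := norm_pow_succ_sub_le hz hζ (n + j)
  have h4 := hc (n + j + 1) (by omega)
  push_cast at h3 h4
  calc ‖taylorCoeff φ (n + j + 1)‖ * ‖z ^ (n + j + 1) - ζ ^ (n + j + 1)‖
      ≤ ‖taylorCoeff φ (n + j + 1)‖ * (((n : ℝ) + j + 1) * r ^ (n + j) * ‖z - ζ‖) :=
        mul_le_mul_of_nonneg_left h3 (norm_nonneg _)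
    _ = ((n : ℝ) + j + 1) * ‖taylorCoeff φ (n + j + 1)‖ * (r ^ (n + j) * ‖z - ζ‖) := by ring
    _ ≤ c (n + j + 1) * (r ^ (n + j) * ‖z - ζ‖) :=
        mul_le_mul_of_nonneg_right h4 (by positivity)
    _ = _ := by ring

/-! ### Two-point estimates and univalence in the class `F(α)` -/

namespace ClassF

variable {α : ℝ} {f h g : ℂ → ℂ}

theorem mul_norm_taylorCoeff_h_le (hf : ClassF α f h g) (hα1 : α < 1) {k : ℕ} (hk : 1 ≤ k) :
    k * ‖taylorCoeff h k‖ ≤ analyticCoeff α k := by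
  obtain ⟨k, rfl⟩ := Nat.exists_eq_add_of_le' hk
  exact mul_le_mul_of_nonneg_left (norm_taylorCoeff_le_coeffBound hα1 hf.analytic_h hf.deriv_h_zero
    hf.deriv_ne_zero hf.convex_order k) (by positivity)

theorem mul_norm_taylorCoeff_g_le (hf : ClassF α f h g) (hα1 : α < 1) {k : ℕ} (hk : 2 ≤ k) :
    k * ‖taylorCoeff g k‖ ≤ coanalyticCoeff α k := by
  obtain ⟨k, rfl⟩ := Nat.exists_eq_add_of_le' hk
  obtain ⟨θ, hθ⟩ := hf.dilatation
  have h0 : ball (0 : ℂ) 1 ∈ 𝓝 (0 : ℂ) := ball_mem_nhds _ one_pos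
  have h1 : taylorCoeff (deriv g) (k + 1) =
      Complex.exp (Complex.I * θ) * (((k : ℂ) + 1) * taylorCoeff h (k + 1)) := by
    rw [← taylorCoeff_deriv, ← taylorCoeff_id_mul_succ
      ((hf.analytic_h.deriv isOpen_ball).analyticAt h0), ← taylorCoeff_const_mul]
    refine taylorCoeff_congr ?_ _
    filter_upwards [h0] with z hz
    rw [hθ z hz, mul_assoc]
  rw [taylorCoeff_deriv] at h1
  have h2 := hf.mul_norm_taylorCoeff_h_le hα1 (k := k + 1) (by omega)
  have h3 := congrArg norm h1
  rw [norm_mul, norm_mul, norm_mul, mul_comm Complex.I, Complex.norm_exp_ofReal_mul_I, one_mul,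
    ← Nat.cast_succ (R := ℂ), ← Nat.cast_succ (R := ℂ), Complex.norm_natCast,
    Complex.norm_natCast] at h3
  rw [coanalyticCoeff, show k + 2 - 1 = k + 1 by omega]
  exact h3.trans_le h2

/-- Two-point distortion for the analytic and co-analytic parts. -/
theorem two_point_distortion (hf : ClassF α f h g) (hα0 : 0 ≤ α) (hα1 : α < 1) {r : ℝ}
    (hr0 : 0 < r) (hr1 : r < 1) {z ζ : ℂ} (hz : ‖z‖ < r) (hζ : ‖ζ‖ < r) :
    ‖g z - g ζ‖ ≤ r * ‖h z - h ζ‖ ∧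
      (1 + r) ^ (2 * α - 2) * ‖z - ζ‖ ≤ ‖h z - h ζ‖ := by
  obtain ⟨θ, hθ⟩ := hf.dilatation
  have hrc : (r : ℂ) ≠ 0 := by exact_mod_cast hr0.ne'
  have hnr : ‖(r : ℂ)‖ = r := by rw [Complex.norm_real, Real.norm_eq_abs, abs_of_pos hr0]
  have hd1 := hf.analytic_h.deriv isOpen_ball
  have hd2 := hd1.deriv isOpen_ball
  have hderiv : ∀ {φ : ℂ → ℂ}, DifferentiableOn ℂ φ (ball 0 1) → ∀ z ∈ ball (0 : ℂ) 1,
      HasDerivAt φ (deriv φ z) z := fun hφ z hz =>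
    (hφ.differentiableAt (isOpen_ball.mem_nhds hz)).hasDerivAt
  have hnorm : ∀ w ∈ ball (0 : ℂ) 1, ‖(r : ℂ) * w‖ ≤ r := by
    intro w hw
    rw [norm_mul, hnr]
    rw [mem_ball_zero_iff] at hw
    nlinarith
  have hmem : ∀ w ∈ ball (0 : ℂ) 1, (r : ℂ) * w ∈ ball (0 : ℂ) 1 := fun w hw =>
    mem_ball_zero_iff.2 ((hnorm w hw).trans_lt hr1)
  have hscale : ∀ {φ φ1 : ℂ → ℂ}, (∀ z ∈ ball (0 : ℂ) 1, HasDerivAt φ (φ1 z) z) →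
      ∀ w ∈ ball (0 : ℂ) 1, HasDerivAt (fun w => φ (r * w)) (φ1 (r * w) * r) w := by
    intro φ φ1 hφ w hw
    have hl : HasDerivAt (fun w : ℂ => (r : ℂ) * w) r w := by
      simpa using (hasDerivAt_id w).const_mul (r : ℂ)
    exact (hφ _ (hmem w hw)).comp w hl
  have hmd : MapsTo (fun w : ℂ => (r : ℂ) * w) (ball 0 1) (ball 0 1) := hmem
  have hld : DifferentiableOn ℂ (fun w : ℂ => (r : ℂ) * w) (ball 0 1) :=
    (differentiableOn_const _).mul differentiableOn_id
  -- The comparison is applied to `h(rw)` on the unit disk, so that bounds for derivatives are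
  -- needed only on `|z| < r`, where the dilatation is at most `r`.
  have key : ∀ {N N1 : ℂ → ℂ} {M : ℝ},
      (∀ w ∈ ball (0 : ℂ) 1, HasDerivAt N (N1 w) w) →
      (∀ w ∈ ball (0 : ℂ) 1, ‖N1 w‖ ≤ M * ‖deriv h (r * w) * r‖) →
      ‖N (z / r) - N (ζ / r)‖ ≤ M * ‖h z - h ζ‖ := by
    intro N N1 M hN hbd
    have := norm_sub_le_mul_norm_sub_of_convex (h := fun w => h (r * w))
      (h1 := fun w => deriv h (r * w) * r) (h2 := fun w => deriv (deriv h) (r * w) * r * r)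
      (hscale (hderiv hf.analytic_h))
      (fun w hw => (hscale (hderiv hd1) w hw).mul_const _)
      (((hd2.comp hld hmd).mul_const _).mul_const _)
      (fun w hw => mul_ne_zero (hf.deriv_ne_zero _ (hmem w hw)) hrc)
      (fun w hw => by
        have h1 := hf.convex_order _ (hmem w hw)
        have h2 := hf.deriv_ne_zero _ (hmem w hw)
        have h3 : w * (deriv (deriv h) (r * w) * r * r) / (deriv h (r * w) * r) =
            r * w * deriv (deriv h) (r * w) / deriv h (r * w) := by
          field_simp
        rw [h3]
        linarith)
      hN hbd (z := z / r) (ζ := ζ / r)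
      (by rw [mem_ball_zero_iff, norm_div, hnr, div_lt_one hr0]; exact hz)
      (by rw [mem_ball_zero_iff, norm_div, hnr, div_lt_one hr0]; exact hζ)
    simpa only [mul_div_cancel₀ _ hrc] using this
  constructor
  · have := key (M := r) (hscale (hderiv hf.analytic_g)) (fun w hw => by
      rw [hθ _ (hmem w hw), mul_assoc, mul_assoc, norm_mul, norm_mul (_ * w), mul_comm Complex.I,
        Complex.norm_exp_ofReal_mul_I, one_mul]
      exact mul_le_mul_of_nonneg_right (hnorm w hw) (norm_nonneg _))
    simpa only [mul_div_cancel₀ _ hrc] using this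
  · have hp : (0 : ℝ) < 1 + r := by linarith
    have hpp : 0 < (1 + r) ^ (2 * α - 2) := Real.rpow_pos_of_pos hp _
    -- Comparing the identity with `h` turns the lower bound for `|h'|` into a lower bound for `|h z
    -- - h ζ|`; the factor `1 / r` in `M` compensates for the rescaling.
    have := key (N := fun w => w) (N1 := fun _ => 1) (M := ((1 + r) ^ (2 * α - 2))⁻¹ / r)
      (fun w _ => hasDerivAt_id w) (fun w hw => by
        have h1 := rpow_neg_le_norm_of_order (β := 1 - α) (by linarith) (hderiv hd1) hd2
          hf.deriv_ne_zero hf.deriv_h_zero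
          (fun w hw => by
            have := hf.convex_order w hw
            linarith) (hmem w hw)
        have h2 : (1 + r) ^ (2 * α - 2) ≤ (1 + ‖(r : ℂ) * w‖) ^ (-(2 * (1 - α))) := by
          rw [show -(2 * (1 - α)) = 2 * α - 2 by ring]
          exact Real.rpow_le_rpow_of_nonpos (by positivity) (by linarith [hnorm w hw])
            (by linarith)
        rw [norm_one, norm_mul, hnr]
        have h3 := h2.trans h1
        rw [div_mul_eq_mul_div, le_div_iff₀ hr0, inv_mul_eq_div, le_div_iff₀ hpp]
        nlinarith)
    rw [← sub_div, norm_div, hnr, div_mul_eq_mul_div, div_le_div_iff_of_pos_right hr0,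
      inv_mul_eq_div, le_div_iff₀ hpp] at this
    linarith

/-- The sections are injective on disks where `psi` is positive. -/
theorem harmonicSection_ne (hf : ClassF α f h g) (hα0 : 0 ≤ α) (hα1 : α < 1) {n m : ℕ}
    (hm : 1 ≤ m) {r : ℝ} (hr0 : 0 < r) (hr1 : r < 1) (hpsi : 0 < psi n m r α) (θ : ℝ) {z ζ : ℂ}
    (hz : ‖z‖ < r) (hζ : ‖ζ‖ < r) (hne : z ≠ ζ) :
    harmonicSection n m θ h g z ≠ harmonicSection n m θ h g ζ := by
  intro heq
  obtain ⟨hg, hh⟩ := hf.two_point_distortion hα0 hα1 hr0 hr1 hz hζ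
  have hA := A_le_jacobianBound hα0 hα1 hr0 hr1
  have hT1 := norm_remainder_sub_le hf.analytic_h hf.h_zero (analyticCoeff_nonneg hα1)
    (analyticCoeff_le hα0 hα1) (n := n) (fun k hk => hf.mul_norm_taylorCoeff_h_le hα1 (by omega))
    hr1 hz.le hζ.le
  have hT2 := norm_remainder_sub_le hf.analytic_g hf.g_zero (coanalyticCoeff_nonneg hα1)
    (coanalyticCoeff_le hα0 hα1) (n := m) (fun k hk => hf.mul_norm_taylorCoeff_g_le hα1 (by omega))
    hr1 hz.le hζ.le
  rw [psi_eq hα1 n hm] at hpsi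
  set T1 := ∑' j : ℕ, analyticCoeff α (n + 1 + j) * r ^ (n + j)
  set T2 := ∑' j : ℕ, coanalyticCoeff α (m + 1 + j) * r ^ (m + j)
  have hd : 0 < ‖z - ζ‖ := norm_pos_iff.2 (sub_ne_zero.2 hne)
  have hsec : ‖partialSum n h z - partialSum n h ζ‖ = ‖partialSum m g z - partialSum m g ζ‖ := by
    have h1 : partialSum n h z - partialSum n h ζ =
        -(Complex.exp (Complex.I * θ) * conj (partialSum m g z - partialSum m g ζ)) := by
      simp only [harmonicSection] at heq
      rw [map_sub]
      linear_combination heq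
    rw [h1, norm_neg, norm_mul, mul_comm Complex.I, Complex.norm_exp_ofReal_mul_I, one_mul,
      RCLike.norm_conj]
  have h2 : ‖h z - h ζ‖ ≤ ‖partialSum n h z - partialSum n h ζ‖ + T1 * ‖z - ζ‖ := by
    have := norm_add_le (partialSum n h z - partialSum n h ζ)
      (h z - partialSum n h z - (h ζ - partialSum n h ζ))
    rw [show partialSum n h z - partialSum n h ζ +
      (h z - partialSum n h z - (h ζ - partialSum n h ζ)) = h z - h ζ by ring] at this
    linarith
  have h3 : ‖partialSum m g z - partialSum m g ζ‖ ≤ ‖g z - g ζ‖ + T2 * ‖z - ζ‖ := by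
    have := norm_sub_le (g z - g ζ) (g z - partialSum m g z - (g ζ - partialSum m g ζ))
    rw [show g z - g ζ - (g z - partialSum m g z - (g ζ - partialSum m g ζ)) =
      partialSum m g z - partialSum m g ζ by ring] at this
    linarith
  have h4 : jacobianBound α r * ‖z - ζ‖ ≤ (1 - r) * ‖h z - h ζ‖ := by
    rw [jacobianBound, mul_assoc]
    exact mul_le_mul_of_nonneg_left hh (by linarith)
  have h5 : A r α * ‖z - ζ‖ ≤ jacobianBound α r * ‖z - ζ‖ :=
    mul_le_mul_of_nonneg_right hA hd.le
  have h6 := mul_pos hpsi hd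
  -- The chain is `A |z - ζ| ≤ (1 - r)|Δh| ≤ |Δh| - |Δg| ≤ (T1 + T2)|z - ζ|`, against `psi > 0`.
  nlinarith

end ClassF

end HarmonicSections

/-! ### The main theorem -/

theorem theorem3 (α : ℝ) (hα0 : 0 ≤ α) (hα1 : α < 1) (n m : ℕ) (hn : 1 ≤ n) (hm : 1 ≤ m) :
    -- the two series in `psi` converge on `(0, 1)`
    (∀ r ∈ Set.Ioo (0 : ℝ) 1,
      Summable (fun j : ℕ => HarmonicSections.analyticTerm α r (n + 1 + j)) ∧
      Summable (fun j : ℕ => HarmonicSections.coanalyticTerm α r (m + 1 + j))) ∧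
    -- `ρ` is the radius `r_{n,m}`, the unique root of `psi` in `(0, 1)`
    ∃ ρ ∈ Set.Ioo (0 : ℝ) 1,
      HarmonicSections.psi n m ρ α = 0 ∧
      (∀ r ∈ Set.Ioo (0 : ℝ) 1, HarmonicSections.psi n m r α = 0 → r = ρ) ∧
      (∀ f h g : ℂ → ℂ, HarmonicSections.ClassF α f h g → ∀ θ : ℝ,
        Set.InjOn (HarmonicSections.harmonicSection n m θ h g) (Metric.ball (0 : ℂ) ρ)) ∧
      (α = 1 / 2 → 3 ≤ min n m →
        1 - 2 * Real.log ((min n m : ℕ) : ℝ) / ((min n m : ℕ) : ℝ) ≤ ρ) := by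
  have hanti := HarmonicSections.psi_strictAntiOn hα0 hα1 n hm
  refine ⟨fun r hr => ?_, ?_⟩
  · have h : |r| < 1 := by rw [abs_of_pos hr.1]; exact hr.2
    constructor
    · simpa only [HarmonicSections.analyticTerm_eq] using HarmonicSections.summable_tail
        (HarmonicSections.analyticCoeff_nonneg hα1) (HarmonicSections.analyticCoeff_le hα0 hα1) n h
    · simpa only [HarmonicSections.coanalyticTerm_eq hα1 r hm] using HarmonicSections.summable_tail
        (HarmonicSections.coanalyticCoeff_nonneg hα1) (HarmonicSections.coanalyticCoeff_le hα0 hα1)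
        m h
  obtain ⟨ρ, hρ, hρ0⟩ := HarmonicSections.exists_psi_eq_zero hα0 hα1 hn hm
  refine ⟨ρ, hρ, hρ0, fun r hr hr0 => hanti.injOn hr hρ (hr0.trans hρ0.symm), ?_, ?_⟩
  · intro f h g hf θ z hz ζ hζ heq
    by_contra hne
    rw [mem_ball_zero_iff] at hz hζ
    -- `psi` vanishes at `ρ` itself, so the estimate is used at a slightly smaller radius, where
    -- `psi` is strictly positive.
    obtain ⟨r, hr, hrρ⟩ := exists_between (max_lt hz hζ)
    have hzr := (le_max_left _ _).trans_lt hr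
    have hr0 : 0 < r := (norm_nonneg z).trans_lt hzr
    have hr1 : r < 1 := hrρ.trans hρ.2
    have hpos : 0 < HarmonicSections.psi n m r α := hρ0.symm.trans_lt (hanti ⟨hr0, hr1⟩ hρ hrρ)
    exact hf.harmonicSection_ne hα0 hα1 hm hr0 hr1 hpos θ hzr
      ((le_max_right _ _).trans_lt hr) hne heq
  · intro hα hl
    subst hα
    by_contra! hlt
    -- The contrary assumption places the claimed bound to the right of `ρ`, hence in `(0, 1)`,
    -- where strict monotonicity makes `psi` negative.
    have hr0 := hρ.1.trans hlt
    have hlog : 0 < Real.log ((min n m : ℕ) : ℝ) :=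
      Real.log_pos (by exact_mod_cast (by omega : 1 < min n m))
    have hlp : (0 : ℝ) < ((min n m : ℕ) : ℝ) := by exact_mod_cast (by omega : 0 < min n m)
    have hr1 : 1 - 2 * Real.log ((min n m : ℕ) : ℝ) / ((min n m : ℕ) : ℝ) < 1 := by
      have : 0 < 2 * Real.log ((min n m : ℕ) : ℝ) / ((min n m : ℕ) : ℝ) := by positivity
      linarith
    have h1 := HarmonicSections.psi_half_nonneg hl (min_le_left n m) (min_le_right n m) hr0
    have h2 := hanti hρ ⟨hr0, hr1⟩ hlt
    simp only [hρ0] at h2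
    linarith
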